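/- For $1\le p\le\infty$ let $L^p(\mathbb{R}^d)$ be the Lebesgue space of complex-valued functions (modulo equality almost everywhere) with respect to Lebesgue measure on $\mathbb{R}^d$. Let $(B_0,B_1)$ be a complex Banach couple, i.e. a pair of complex Banach spaces that are both continuously embedded into a Hausdorff topological vector space, and equip $B_0+B_1$ with the norm $\|v\|_{B_0+B_1}=\inf\{\|v_0\|_{B_0}+\|v_1\|_{B_1} : v=v_0+v_1,\ v_0\in B_0,\ v_1\in B_1\}$. Put $S=\{z\in\mathbb{C}: 0\le \operatorname{Re} z\le 1\}$, and let $\mathcal{F}(B_0,B_1)$ be the set of all functions $f:S\to B_0+B_1$ such that (a) $f$ is continuous and bounded on $S$ with respect to the norm of $B_0+B_1$; (b) for every bounded linear functional $l$ on $B_0+B_1$, the function $l\circ f$ is holomorphic in the interior of $S$; (c) for $j=0,1$, $f$ maps the line $\operatorname{Re} z=j$ into $B_j$, and $y\mapsto f(j+iy)$ is continuous from $\mathbb{R}$ to $B_j$ with $\|f(j+iy)\|_{B_j}\to 0$ as $|y|\to\infty$. For $f\in\mathcal{F}(B_0,B_1)$ put $\|f\|_{\mathcal{F}}=\max\{\sup_{y\in\mathbb{R}}\|f(iy)\|_{B_0},\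 \sup_{y\in\mathbb{R}}\|f(1+iy)\|_{B_1}\}$. The complex interpolation space of order $\theta$ is $$[B_0,B_1]_\theta=\{f(\theta): f\in\mathcal{F}(B_0,B_1)\},\qquad \|v\|_{[B_0,B_1]_\theta}=\inf\{\|f\|_{\mathcal{F}} : f\in\mathcal{F}(B_0,B_1),\ f(\theta)=v\}.$$ **Theorem.** Let $p_0,p_1\in[1,\infty]$ and $\theta\in(0,1)$, and define $p_\theta\in[1,\infty]$ by $$\frac1{p_\theta}=\frac{1-\theta}{p_0}+\frac{\theta}{p_1}\qquad(\text{with } 1/\infty=0).$$ Then, for the couple $(L^{p_0}(\mathbb{R}^d),L^{p_1}(\mathbb{R}^d))$, with both spaces regarded as subspaces of the space of locally integrable functions on $\mathbb{R}^d$ with the topology of $L^1$ convergence on bounded sets, $$[L^{p_0}(\mathbb{R}^d),L^{p_1}(\mathbb{R}^d)]_\theta=L^{p_\theta}(\mathbb{R}^d)$$ as sets of (classes of) functions, and $\|v\|_{[L^{p_0},L^{p_1}]_\theta}=\|v\|_{L^{p_\theta}}$ for every $v$ in this space. -/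

import Mathlib

open MeasureTheory Set Topology
open scoped ENNReal NNReal

noncomputable section

/-- A complex Banach couple: two complex Banach spaces `B₀`, `B₁`, both continuously embedded
into a Hausdorff topological vector space `V`. -/
structure BanachCouple (B₀ B₁ V : Type*)
    [NormedAddCommGroup B₀] [NormedSpace ℂ B₀] [CompleteSpace B₀]
    [NormedAddCommGroup B₁] [NormedSpace ℂ B₁] [CompleteSpace B₁]
    [AddCommGroup V] [Module ℂ V] [TopologicalSpace V]
    [IsTopologicalAddGroup V] [ContinuousSMul ℂ V] [T2Space V] where
  emb₀ : B₀ →L[ℂ] V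
  emb₁ : B₁ →L[ℂ] V
  emb₀_injective : Function.Injective emb₀
  emb₁_injective : Function.Injective emb₁

namespace BanachCouple

variable {B₀ B₁ V : Type*}
    [NormedAddCommGroup B₀] [NormedSpace ℂ B₀] [CompleteSpace B₀]
    [NormedAddCommGroup B₁] [NormedSpace ℂ B₁] [CompleteSpace B₁]
    [AddCommGroup V] [Module ℂ V] [TopologicalSpace V]
    [IsTopologicalAddGroup V] [ContinuousSMul ℂ V] [T2Space V]

/-- `B₀ + B₁` as a linear subspace of the ambient space. -/
def sumSubmodule (C : BanachCouple B₀ B₁ V) : Submodule ℂ V :=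
  LinearMap.range (C.emb₀ : B₀ →ₗ[ℂ] V) ⊔ LinearMap.range (C.emb₁ : B₁ →ₗ[ℂ] V)

/-- The space `B₀ + B₁`. It is a type of its own because it carries the norm of `B₀ + B₁`
defined below, and not the topology of the ambient space. -/
def SumSpace (C : BanachCouple B₀ B₁ V) : Type _ := ↥C.sumSubmodule

instance (C : BanachCouple B₀ B₁ V) : AddCommGroup C.SumSpace :=
  inferInstanceAs (AddCommGroup ↥C.sumSubmodule)

instance (C : BanachCouple B₀ B₁ V) : Module ℂ C.SumSpace :=
  inferInstanceAs (Module ℂ ↥C.sumSubmodule)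

/-- The inclusion of `B₀ + B₁` into the ambient space. -/
def toAmbient (C : BanachCouple B₀ B₁ V) : C.SumSpace →ₗ[ℂ] V := C.sumSubmodule.subtype

theorem toAmbient_injective (C : BanachCouple B₀ B₁ V) : Function.Injective C.toAmbient :=
  Subtype.val_injective

/-- The values `‖b₀‖ + ‖b₁‖` over all decompositions `v = b₀ + b₁`. -/
def sumNormSet (C : BanachCouple B₀ B₁ V) (v : C.SumSpace) : Set ℝ :=
  {r | ∃ (b₀ : B₀) (b₁ : B₁), C.emb₀ b₀ + C.emb₁ b₁ = C.toAmbient v ∧ r = ‖b₀‖ + ‖b₁‖}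

/-- The norm of `B₀ + B₁`: the infimum of `‖b₀‖ + ‖b₁‖` over all decompositions. -/
instance (C : BanachCouple B₀ B₁ V) : Norm C.SumSpace := ⟨fun v => sInf (C.sumNormSet v)⟩

theorem norm_sum_def (C : BanachCouple B₀ B₁ V) (v : C.SumSpace) :
    ‖v‖ = sInf (C.sumNormSet v) := rfl

theorem sumNormSet_nonempty (C : BanachCouple B₀ B₁ V) (v : C.SumSpace) :
    (C.sumNormSet v).Nonempty := by
  obtain ⟨_, ⟨a, rfl⟩, _, ⟨b, rfl⟩, hab⟩ := Submodule.mem_sup.1 v.2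
  exact ⟨_, a, b, hab, rfl⟩

theorem sumNormSet_nonneg (C : BanachCouple B₀ B₁ V) (v : C.SumSpace) :
    ∀ r ∈ C.sumNormSet v, 0 ≤ r := by
  rintro _ ⟨a, b, -, rfl⟩
  positivity

theorem sumNormSet_bddBelow (C : BanachCouple B₀ B₁ V) (v : C.SumSpace) :
    BddBelow (C.sumNormSet v) := ⟨0, C.sumNormSet_nonneg v⟩

theorem norm_sum_smul_le (C : BanachCouple B₀ B₁ V) (c : ℂ) (v : C.SumSpace) :
    ‖c • v‖ ≤ ‖c‖ * ‖v‖ := by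
  rw [norm_sum_def C v, ← smul_eq_mul, ← Real.sInf_smul_of_nonneg (norm_nonneg c)]
  refine le_csInf ((C.sumNormSet_nonempty v).image _) ?_
  rintro _ ⟨_, ⟨a, b, hab, rfl⟩, rfl⟩
  refine csInf_le (C.sumNormSet_bddBelow _) ⟨c • a, c • b, ?_, ?_⟩
  · rw [map_smul, map_smul, map_smul, ← hab, smul_add]
  · simp [norm_smul, mul_add]

theorem sumCore (C : BanachCouple B₀ B₁ V) : NormedSpace.Core ℂ C.SumSpace where
  norm_nonneg v := Real.sInf_nonneg (C.sumNormSet_nonneg v)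
  norm_smul c v := by
    refine le_antisymm (C.norm_sum_smul_le c v) ?_
    rcases eq_or_ne c 0 with rfl | hc
    · rw [norm_zero, zero_mul]
      exact Real.sInf_nonneg (C.sumNormSet_nonneg _)
    · have h := C.norm_sum_smul_le c⁻¹ (c • v)
      rw [inv_smul_smul₀ hc, norm_inv] at h
      rwa [le_inv_mul_iff₀ (norm_pos_iff.2 hc)] at h
  norm_triangle v w := by
    refine le_of_forall_pos_le_add fun ε hε => ?_
    obtain ⟨_, ⟨a, b, hab, rfl⟩, h₁⟩ :=
      Real.lt_sInf_add_pos (C.sumNormSet_nonempty v) (half_pos hε)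
    obtain ⟨_, ⟨a', b', hab', rfl⟩, h₂⟩ :=
      Real.lt_sInf_add_pos (C.sumNormSet_nonempty w) (half_pos hε)
    have h₃ : ‖v + w‖ ≤ ‖a + a'‖ + ‖b + b'‖ :=
      csInf_le (C.sumNormSet_bddBelow _) ⟨a + a', b + b', by
        rw [map_add, map_add, map_add, ← hab, ← hab']; abel, rfl⟩
    rw [norm_sum_def C v, norm_sum_def C w]
    linarith [norm_add_le a a', norm_add_le b b']
  norm_eq_zero_iff v := by
    constructor
    · intro h
      have key : ∀ n : ℕ, ∃ (a : B₀) (b : B₁),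
          C.emb₀ a + C.emb₁ b = C.toAmbient v ∧ ‖a‖ + ‖b‖ < 1 / ((n : ℝ) + 1) := by
        intro n
        obtain ⟨_, ⟨a, b, hab, rfl⟩, h₁⟩ :=
          Real.lt_sInf_add_pos (C.sumNormSet_nonempty v) (Nat.one_div_pos_of_nat (α := ℝ) (n := n))
        rw [norm_sum_def] at h
        exact ⟨a, b, hab, by simpa [h] using h₁⟩
      choose a b hab hlt using key
      have ha : Filter.Tendsto a Filter.atTop (𝓝 0) :=
        squeeze_zero_norm (fun n => by linarith [hlt n, norm_nonneg (b n)])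
          tendsto_one_div_add_atTop_nhds_zero_nat
      have hb : Filter.Tendsto b Filter.atTop (𝓝 0) :=
        squeeze_zero_norm (fun n => by linarith [hlt n, norm_nonneg (a n)])
          tendsto_one_div_add_atTop_nhds_zero_nat
      have h0 := ((C.emb₀.continuous.tendsto 0).comp ha).add
        ((C.emb₁.continuous.tendsto 0).comp hb)
      have hc : (fun n => (C.emb₀ ∘ a) n + (C.emb₁ ∘ b) n) = fun _ => C.toAmbient v :=
        funext hab
      rw [hc, map_zero, map_zero, add_zero] at h0
      refine C.toAmbient_injective ?_
      rw [map_zero]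
      exact tendsto_nhds_unique tendsto_const_nhds h0
    · rintro rfl
      refine le_antisymm (csInf_le (C.sumNormSet_bddBelow _) ⟨0, 0, by simp, by simp⟩)
        (Real.sInf_nonneg (C.sumNormSet_nonneg _))

instance (C : BanachCouple B₀ B₁ V) : NormedAddCommGroup C.SumSpace :=
  NormedAddCommGroup.ofCore C.sumCore

instance (C : BanachCouple B₀ B₁ V) : NormedSpace ℂ C.SumSpace := NormedSpace.ofCore C.sumCore

/-- The closed strip `0 ≤ Re z ≤ 1`. -/
def strip : Set ℂ := {z | 0 ≤ z.re ∧ z.re ≤ 1}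

/-- The open strip `0 < Re z < 1`. -/
def openStrip : Set ℂ := {z | 0 < z.re ∧ z.re < 1}

/-- The space-generating functions of the couple. A function on the closed strip is represented
by a function on `ℂ` of which only the values on the strip matter. Holomorphic means that the
composition with each bounded linear functional on `B₀ + B₁` is holomorphic. The boundary values
on `Re z = 0` and `Re z = 1` are recorded as functions `trace₀`, `trace₁` of `Im z`; they are
determined by the function because the embeddings are injective, and `C₀(ℝ, B)` is the type
of the norm-continuous functions `ℝ → B` that tend to zero in norm at infinity. -/
structure SpaceGeneratingFunction (C : BanachCouple B₀ B₁ V) where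
  toFun : ℂ → C.SumSpace
  continuousOn : ContinuousOn toFun strip
  bounded : ∃ M : ℝ, ∀ z ∈ strip, ‖toFun z‖ ≤ M
  holomorphic : ∀ l : C.SumSpace →L[ℂ] ℂ, DifferentiableOn ℂ (fun z => l (toFun z)) openStrip
  trace₀ : ZeroAtInftyContinuousMap ℝ B₀
  trace₁ : ZeroAtInftyContinuousMap ℝ B₁
  toFun_line₀ : ∀ y : ℝ, C.toAmbient (toFun (Complex.I * y)) = C.emb₀ (trace₀ y)
  toFun_line₁ : ∀ y : ℝ, C.toAmbient (toFun (1 + Complex.I * y)) = C.emb₁ (trace₁ y)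

/-- `max (sup_y ‖f(iy)‖_{B₀}) (sup_y ‖f(1+iy)‖_{B₁})`. -/
def SpaceGeneratingFunction.fnorm {C : BanachCouple B₀ B₁ V}
    (f : C.SpaceGeneratingFunction) : ℝ :=
  max (⨆ y : ℝ, ‖f.trace₀ y‖) (⨆ y : ℝ, ‖f.trace₁ y‖)

/-- The complex interpolation space `[B₀, B₁]_θ`, as a linear subspace of the ambient space:
all the values `f(θ)` of space-generating functions `f`. -/
def interpolationSpace (C : BanachCouple B₀ B₁ V) (θ : ℝ) : Submodule ℂ V where
  carrier := {v | ∃ f : C.SpaceGeneratingFunction, C.toAmbient (f.toFun (θ : ℂ)) = v}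
  zero_mem' :=
    ⟨{  toFun := fun _ => 0
        continuousOn := continuousOn_const
        bounded := ⟨0, fun z _ => by simp⟩
        holomorphic := fun l => by simp
        trace₀ := 0
        trace₁ := 0
        toFun_line₀ := fun y => by simp
        toFun_line₁ := fun y => by simp }, by simp⟩
  add_mem' := by
    rintro _ _ ⟨f, rfl⟩ ⟨g, rfl⟩
    refine ⟨{ toFun := fun z => f.toFun z + g.toFun z
              continuousOn := f.continuousOn.add g.continuousOn
              bounded := ?_
              holomorphic := fun l => ?_
              trace₀ := f.trace₀ + g.trace₀
              trace₁ := f.trace₁ + g.trace₁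
              toFun_line₀ := fun y => by simp [f.toFun_line₀, g.toFun_line₀]
              toFun_line₁ := fun y => by simp [f.toFun_line₁, g.toFun_line₁] }, by simp⟩
    · obtain ⟨M, hM⟩ := f.bounded
      obtain ⟨N, hN⟩ := g.bounded
      exact ⟨M + N, fun z hz => (norm_add_le _ _).trans (add_le_add (hM z hz) (hN z hz))⟩
    · simpa only [map_add] using! (f.holomorphic l).add (g.holomorphic l)
  smul_mem' := by
    rintro c _ ⟨f, rfl⟩
    refine ⟨{ toFun := fun z => c • f.toFun z
              continuousOn := f.continuousOn.const_smul c
              bounded := ?_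
              holomorphic := fun l => ?_
              trace₀ := c • f.trace₀
              trace₁ := c • f.trace₁
              toFun_line₀ := fun y => by simp [f.toFun_line₀]
              toFun_line₁ := fun y => by simp [f.toFun_line₁] }, by simp⟩
    · obtain ⟨M, hM⟩ := f.bounded
      exact ⟨‖c‖ * M, fun z hz => by
        rw [norm_smul]; exact mul_le_mul_of_nonneg_left (hM z hz) (norm_nonneg c)⟩
    · simpa only [map_smul] using! (f.holomorphic l).const_smul c

/-- The norm of `[B₀, B₁]_θ`: the infimum of the norms of the space-generating functions `f`
with `f(θ) = v`. It is meaningful for `v` in `C.interpolationSpace θ`. -/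
def interpolationNorm (C : BanachCouple B₀ B₁ V) (θ : ℝ) (v : V) : ℝ :=
  sInf {r | ∃ f : C.SpaceGeneratingFunction, C.toAmbient (f.toFun (θ : ℂ)) = v ∧ r = f.fnorm}

end BanachCouple

/-- The complex vector space of (a.e. classes of) locally integrable functions on `ℝ^d`. -/
def L1loc (d : ℕ) : Submodule ℂ (EuclideanSpace ℝ (Fin d) →ₘ[volume] ℂ) where
  carrier := {f | LocallyIntegrable f volume}
  zero_mem' := locallyIntegrable_zero.congr AEEqFun.coeFn_zero.symm
  add_mem' := fun {f g} hf hg => (LocallyIntegrable.add hf hg).congr (AEEqFun.coeFn_add f g).symm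
  smul_mem' := fun c f hf => (LocallyIntegrable.smul hf c).congr (AEEqFun.coeFn_smul c f).symm

namespace L1loc

variable {d : ℕ}

theorem integrableOn (f : L1loc d) (n : ℕ) :
    IntegrableOn f.1 (Metric.closedBall 0 (n : ℝ)) volume :=
  LocallyIntegrable.integrableOn_isCompact f.2 (isCompact_closedBall _ _)

/-- The seminorm `f ↦ ∫_{|x| ≤ n} |f|`. -/
def ballSeminorm (d : ℕ) : SeminormFamily ℂ (L1loc d) ℕ := fun n =>
  Seminorm.of (fun f => ∫ x in Metric.closedBall 0 (n : ℝ), ‖f.1 x‖)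
    (fun f g => by
      rw [← integral_add (integrableOn f n).norm (integrableOn g n).norm]
      refine integral_mono_ae (integrableOn (f + g) n).norm
        ((integrableOn f n).norm.add (integrableOn g n).norm) ?_
      filter_upwards [ae_restrict_of_ae (AEEqFun.coeFn_add f.1 g.1)] with x hx
      simp only [Submodule.coe_add, hx, Pi.add_apply]
      exact norm_add_le _ _)
    (fun c f => by
      rw [← integral_const_mul]
      refine integral_congr_ae ?_
      filter_upwards [ae_restrict_of_ae (AEEqFun.coeFn_smul c f.1)] with x hx
      simp only [Submodule.coe_smul, hx, Pi.smul_apply, norm_smul])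

theorem ballSeminorm_apply (n : ℕ) (f : L1loc d) :
    ballSeminorm d n f = ∫ x in Metric.closedBall 0 (n : ℝ), ‖f.1 x‖ := rfl

/-- The topology of `L¹` convergence on bounded sets. -/
instance : TopologicalSpace (L1loc d) := (ballSeminorm d).moduleFilterBasis.topology

theorem withSeminorms : WithSeminorms (ballSeminorm d) := ⟨rfl⟩

instance : IsTopologicalAddGroup (L1loc d) := withSeminorms.topologicalAddGroup

instance : ContinuousSMul ℂ (L1loc d) := withSeminorms.continuousSMul

instance : T2Space (L1loc d) := by
  have : T1Space (L1loc d) := by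
    refine withSeminorms.T1_of_separating fun f hf => ?_
    by_contra! h
    refine hf (Subtype.ext (AEEqFun.ext ?_))
    have h1 : ∀ n : ℕ, ∀ᵐ x ∂(volume.restrict (Metric.closedBall 0 (n : ℝ))), f.1 x = 0 := by
      intro n
      have h2 := h n
      rw [ballSeminorm_apply, integral_eq_zero_iff_of_nonneg (fun x => norm_nonneg _)
        (integrableOn f n).norm] at h2
      filter_upwards [h2] with x hx
      simpa using hx
    have h3 := ae_restrict_iUnion_iff (μ := volume)
      (fun n : ℕ => Metric.closedBall (0 : EuclideanSpace ℝ (Fin d)) (n : ℝ))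
      (fun x => f.1 x = 0) |>.2 h1
    rw [Metric.iUnion_closedBall_nat, Measure.restrict_univ] at h3
    filter_upwards [h3, AEEqFun.coeFn_zero (μ := volume) (α := EuclideanSpace ℝ (Fin d))
      (β := ℂ)] with x hx hx0
    rw [hx]
    exact hx0.symm
  infer_instance

end L1loc

/-- The inclusion of `L^p(ℝ^d)` into the locally integrable functions. -/
def lpInclusion (d : ℕ) (p : ℝ≥0∞) [Fact (1 ≤ p)] :
    Lp ℂ p (volume : Measure (EuclideanSpace ℝ (Fin d))) →L[ℂ] L1loc d where
  toFun f := ⟨f.1, (Lp.memLp f).locallyIntegrable Fact.out⟩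
  map_add' _ _ := rfl
  map_smul' _ _ := rfl
  cont := by
    refine L1loc.withSeminorms.continuous_normedSpace_dom (𝕝 := ℂ)
      (E := Lp ℂ p (volume : Measure (EuclideanSpace ℝ (Fin d))))
      (f := ({  toFun := fun f => ⟨f.1, (Lp.memLp f).locallyIntegrable Fact.out⟩
                map_add' := fun _ _ => rfl
                map_smul' := fun _ _ => rfl } : _ →ₗ[ℂ] L1loc d)) fun n => ?_
    set K : Set (EuclideanSpace ℝ (Fin d)) := Metric.closedBall 0 (n : ℝ) with hK
    have hfin : volume K ≠ ∞ := measure_closedBall_lt_top.ne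
    have hp : (1 : ℝ≥0∞) ≤ p := Fact.out
    have hexp : 0 ≤ 1 / (1 : ℝ≥0∞).toReal - 1 / p.toReal := by
      rcases eq_or_ne p ∞ with rfl | hp'
      · simp
      · have : 1 ≤ p.toReal := by
          simpa using ENNReal.toReal_mono hp' hp
        simp only [ENNReal.toReal_one, div_one, one_div, sub_nonneg]
        exact inv_le_one_of_one_le₀ this
    have hC : volume K ^ (1 / (1 : ℝ≥0∞).toReal - 1 / p.toReal) ≠ ∞ :=
      ENNReal.rpow_ne_top_of_nonneg hexp hfin
    refine ⟨(volume K ^ (1 / (1 : ℝ≥0∞).toReal - 1 / p.toReal)).toNNReal, fun f => ?_⟩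
    have hm : MemLp f p (volume.restrict K) := (Lp.memLp f).restrict K
    have h1 : eLpNorm f 1 (volume.restrict K) ≤
        eLpNorm f p volume * volume K ^ (1 / (1 : ℝ≥0∞).toReal - 1 / p.toReal) := by
      refine (eLpNorm_le_eLpNorm_mul_rpow_measure_univ hp hm.1).trans ?_
      rw [Measure.restrict_apply_univ]
      gcongr
      exact Measure.restrict_le_self
    have h2 : (∫ x in K, ‖f x‖) = (eLpNorm f 1 (volume.restrict K)).toReal := by
      rw [eLpNorm_one_eq_lintegral_enorm, integral_norm_eq_lintegral_enorm hm.1]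
    change (∫ x in K, ‖f x‖) ≤ _ * ‖f‖
    rw [h2, Lp.norm_def, ENNReal.coe_toNNReal_eq_toReal, mul_comm, ← ENNReal.toReal_mul]
    exact ENNReal.toReal_mono (ENNReal.mul_ne_top (Lp.memLp f).2.ne hC) h1

/-- The Banach couple `(L^{p₀}(ℝ^d), L^{p₁}(ℝ^d))`. -/
def lpCouple (d : ℕ) (p₀ p₁ : ℝ≥0∞) [Fact (1 ≤ p₀)] [Fact (1 ≤ p₁)] :
    BanachCouple (Lp ℂ p₀ (volume : Measure (EuclideanSpace ℝ (Fin d))))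
      (Lp ℂ p₁ (volume : Measure (EuclideanSpace ℝ (Fin d)))) (L1loc d) where
  emb₀ := lpInclusion d p₀
  emb₁ := lpInclusion d p₁
  emb₀_injective := fun _ _ h => Subtype.ext (congrArg (fun u : L1loc d => u.1) h)
  emb₁_injective := fun _ _ h => Subtype.ext (congrArg (fun u : L1loc d => u.1) h)

end

/-!
Write `1 / p_θ = (1 - θ) / p₀ + θ / p₁`. The theorem follows from two estimates.

* `exists_spaceGeneratingFunction`: every `v ∈ L^{p_θ}` is `f(θ)` for a space-generating function
  `f` whose norm exceeds `‖v‖` by as little as desired. If `v` is a simple function and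
  `p_θ < ∞`, take
  `f(z) = exp(ε (z² - θ²)) ‖v‖ sgn v (|v| / ‖v‖) ^ (p_θ ((1 - z) / p₀ + z / p₁))`.
  On the line `Re z = j` the modulus of `f` is at most
  `exp ε · ‖v‖ · H ^ (1 / p_j)` with `∫ H = 1`, so its norm in `L^{p_j}` is at most `exp ε · ‖v‖`.
  For a general `v` this formula need not be continuous into `L^{p_j}` when `p_j = ∞`, so `v` is
  written as a rapidly convergent series of simple functions and the space-generating functions
  are summed. Such series converge (`SpaceGeneratingFunction.exists_tsum`) because `B₀ + B₁` is
  complete and, by the maximum principle `SpaceGeneratingFunction.norm_toFun_le`, the norm of `f`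
  controls `f` on the whole strip. If `p_θ = ∞` then `p₀ = p₁ = ∞` and
  `f(z) = exp(ε (z² - θ²)) v` will do.

* `eLpNorm_le_fnorm`: if `v = f(θ)` then `‖v‖_{p_θ} ≤ ‖f‖`. For finitely many disjoint bounded
  sets `Eᵢ` and weights `hᵢ > 0` put `A = ∑ hᵢ |Eᵢ|` and
  `F(z) = ∑ hᵢ ^ (1 - (1 - z) / p₀ - z / p₁) ∫_{Eᵢ} conj (sgn v) f(z)`.
  Hölder's inequality bounds `F` by `‖f‖ A ^ (1 - 1 / p_j)` on the line `Re z = j`, hence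
  `|F(θ)| ≤ ‖f‖ A ^ (1 - 1 / p_θ)` by the three lines theorem. If `|v| ≥ c hᵢ ^ (1 / p_θ)` on `Eᵢ`
  then `F(θ) ≥ c A`, so `c A ≤ ‖f‖ A ^ (1 - 1 / p_θ)` (`mul_sum_le_fnorm_mul_rpow`). Applied to
  thin level sets of `|v|` this bounds `∫ |v| ^ p_θ`; applied to a bounded set where `|v| > c > ‖f‖`
  in the case `p_θ = ∞` it shows that the set is null. No duality of Lebesgue spaces is needed.
-/

/-! ### The three lines theorem on the strip -/

theorem BanachCouple.norm_le_of_norm_le_on_lines {F : ℂ → ℂ} {a b : ℝ}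
    (hc : ContinuousOn F strip) (hd : DifferentiableOn ℂ F openStrip)
    (hB : ∃ M : ℝ, ∀ z ∈ strip, ‖F z‖ ≤ M)
    (ha : ∀ y : ℝ, ‖F (Complex.I * y)‖ ≤ a) (hb : ∀ y : ℝ, ‖F (1 + Complex.I * y)‖ ≤ b)
    {z : ℂ} (hz : z ∈ strip) : ‖F z‖ ≤ a ^ (1 - z.re) * b ^ z.re := by
  have hcl : closure (Complex.HadamardThreeLines.verticalStrip 0 1) ⊆ strip :=
    closure_minimal (fun w hw => ⟨hw.1.le, hw.2.le⟩)
      (isClosed_Icc.preimage Complex.continuous_re)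
  refine Complex.HadamardThreeLines.norm_le_interp_of_mem_verticalClosedStrip₀₁' F hz
    ⟨hd, hc.mono hcl⟩ ?_ ?_ ?_
  · obtain ⟨M, hM⟩ := hB
    refine ⟨M, ?_⟩
    rintro _ ⟨w, hw, rfl⟩
    exact hM w hw
  · intro w (hw : w.re = 0)
    have : w = Complex.I * (w.im : ℂ) := by apply Complex.ext <;> simp [hw]
    rw [this]; exact ha _
  · intro w (hw : w.re = 1)
    have : w = 1 + Complex.I * (w.im : ℂ) := by apply Complex.ext <;> simp [hw]
    rw [this]; exact hb _

theorem BanachCouple.isOpen_openStrip : IsOpen openStrip :=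
  isOpen_Ioo.preimage Complex.continuous_re

theorem BanachCouple.openStrip_subset_strip : openStrip ⊆ strip := fun _ h => ⟨h.1.le, h.2.le⟩

theorem BanachCouple.line_zero_mem_strip (y : ℝ) : Complex.I * (y : ℂ) ∈ strip := by
  simp [strip]

theorem BanachCouple.line_one_mem_strip (y : ℝ) : 1 + Complex.I * (y : ℂ) ∈ strip := by
  simp [strip]

/-! ### The norm of `C₀(ℝ, B)` -/

theorem ZeroAtInftyContinuousMap.norm_eq_iSup {B : Type*} [NormedAddCommGroup B]
    (f : ZeroAtInftyContinuousMap ℝ B) : ‖f‖ = ⨆ y : ℝ, ‖f y‖ := by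
  rw [← ZeroAtInftyContinuousMap.norm_toBCF_eq_norm, BoundedContinuousFunction.norm_eq_iSup_norm]
  rfl

theorem ZeroAtInftyContinuousMap.norm_apply_le {B : Type*} [NormedAddCommGroup B]
    (f : ZeroAtInftyContinuousMap ℝ B) (y : ℝ) : ‖f y‖ ≤ ‖f‖ :=
  f.toBCF.norm_coe_le_norm y

/-- Evaluation at a point, as a continuous linear map on `C₀(ℝ, B)`. -/
noncomputable def ZeroAtInftyContinuousMap.evalL {B : Type*} [NormedAddCommGroup B]
    [NormedSpace ℂ B] (y : ℝ) : ZeroAtInftyContinuousMap ℝ B →L[ℂ] B :=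
  LinearMap.mkContinuous { toFun := fun f => f y, map_add' := fun _ _ => rfl,
                           map_smul' := fun _ _ => rfl } 1
    (fun f => by simpa using f.norm_apply_le y)

/-! ### The sum of a Banach couple -/

namespace BanachCouple

variable {B₀ B₁ V : Type*}
    [NormedAddCommGroup B₀] [NormedSpace ℂ B₀] [CompleteSpace B₀]
    [NormedAddCommGroup B₁] [NormedSpace ℂ B₁] [CompleteSpace B₁]
    [AddCommGroup V] [Module ℂ V] [TopologicalSpace V]
    [IsTopologicalAddGroup V] [ContinuousSMul ℂ V] [T2Space V]

theorem norm_sum_le (C : BanachCouple B₀ B₁ V) {v : C.SumSpace} {b₀ : B₀} {b₁ : B₁}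
    (h : C.emb₀ b₀ + C.emb₁ b₁ = C.toAmbient v) : ‖v‖ ≤ ‖b₀‖ + ‖b₁‖ :=
  csInf_le (C.sumNormSet_bddBelow _) ⟨b₀, b₁, h, rfl⟩

theorem exists_decomposition_lt (C : BanachCouple B₀ B₁ V) {v : C.SumSpace} {r : ℝ}
    (h : ‖v‖ < r) : ∃ b₀ b₁, C.emb₀ b₀ + C.emb₁ b₁ = C.toAmbient v ∧ ‖b₀‖ + ‖b₁‖ < r := by
  obtain ⟨_, ⟨a, b, hab, rfl⟩, hlt⟩ := exists_lt_of_csInf_lt (C.sumNormSet_nonempty v) h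
  exact ⟨a, b, hab, hlt⟩

/-- The inclusion `B₀ → B₀ + B₁`. -/
noncomputable def incl₀ (C : BanachCouple B₀ B₁ V) : B₀ →L[ℂ] C.SumSpace :=
  LinearMap.mkContinuous
    { toFun := fun b => (⟨C.emb₀ b, Submodule.mem_sup_left ⟨b, rfl⟩⟩ : C.sumSubmodule)
      map_add' := fun a b => Subtype.ext (map_add C.emb₀ a b)
      map_smul' := fun c b => Subtype.ext (map_smul C.emb₀ c b) } 1
    (fun b => by
      refine (C.norm_sum_le (b₀ := b) (b₁ := 0) ?_).trans (by simp)
      rw [map_zero, add_zero]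
      rfl)

/-- The inclusion `B₁ → B₀ + B₁`. -/
noncomputable def incl₁ (C : BanachCouple B₀ B₁ V) : B₁ →L[ℂ] C.SumSpace :=
  LinearMap.mkContinuous
    { toFun := fun b => (⟨C.emb₁ b, Submodule.mem_sup_right ⟨b, rfl⟩⟩ : C.sumSubmodule)
      map_add' := fun a b => Subtype.ext (map_add C.emb₁ a b)
      map_smul' := fun c b => Subtype.ext (map_smul C.emb₁ c b) } 1
    (fun b => by
      refine (C.norm_sum_le (b₀ := 0) (b₁ := b) ?_).trans (by simp)
      rw [map_zero, zero_add]
      rfl)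

@[simp] theorem toAmbient_incl₀ (C : BanachCouple B₀ B₁ V) (b : B₀) :
    C.toAmbient (C.incl₀ b) = C.emb₀ b := rfl

@[simp] theorem toAmbient_incl₁ (C : BanachCouple B₀ B₁ V) (b : B₁) :
    C.toAmbient (C.incl₁ b) = C.emb₁ b := rfl

theorem norm_incl₀_le (C : BanachCouple B₀ B₁ V) (b : B₀) : ‖C.incl₀ b‖ ≤ ‖b‖ := by
  simpa using C.norm_sum_le (v := C.incl₀ b) (b₀ := b) (b₁ := 0) (by simp)

theorem norm_incl₁_le (C : BanachCouple B₀ B₁ V) (b : B₁) : ‖C.incl₁ b‖ ≤ ‖b‖ := by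
  simpa using C.norm_sum_le (v := C.incl₁ b) (b₀ := 0) (b₁ := b) (by simp)

/-- The norm of `B₀ + B₁` is finer than the topology of the ambient space. -/
theorem continuous_toAmbient (C : BanachCouple B₀ B₁ V) : Continuous C.toAmbient := by
  refine continuous_of_continuousAt_zero C.toAmbient ?_
  have h2 : ContinuousAt (fun p : B₀ × B₁ => C.emb₀ p.1 + C.emb₁ p.2) (0, 0) := by fun_prop
  unfold ContinuousAt at h2 ⊢
  simp only [map_zero, add_zero] at h2 ⊢
  intro U hU
  obtain ⟨δ, hδ, hball⟩ := Metric.mem_nhds_iff.1 (h2 hU)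
  refine Metric.mem_nhds_iff.2 ⟨δ, hδ, fun v hv => ?_⟩
  obtain ⟨a, b, hab, hlt⟩ := C.exists_decomposition_lt (mem_ball_zero_iff.1 hv)
  have : (a, b) ∈ Metric.ball ((0 : B₀), (0 : B₁)) δ := by
    rw [← Prod.zero_eq_mk, mem_ball_zero_iff, Prod.norm_mk]
    exact max_lt (by linarith [norm_nonneg b]) (by linarith [norm_nonneg a])
  have := hball this
  simpa [hab] using this

/-- The inclusion of `B₀ + B₁` into the ambient space, as a continuous linear map. -/
noncomputable def toAmbientL (C : BanachCouple B₀ B₁ V) : C.SumSpace →L[ℂ] V :=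
  ⟨C.toAmbient, C.continuous_toAmbient⟩

@[simp] theorem toAmbientL_apply (C : BanachCouple B₀ B₁ V) (v : C.SumSpace) :
    C.toAmbientL v = C.toAmbient v := rfl

instance (C : BanachCouple B₀ B₁ V) : CompleteSpace C.SumSpace := by
  refine NormedAddCommGroup.completeSpace_of_summable_imp_tendsto fun u hu => ?_
  -- nearly optimal decompositions, with summable errors, give convergent series in `B₀` and `B₁`
  have key : ∀ n, ∃ (a : B₀) (b : B₁), C.emb₀ a + C.emb₁ b = C.toAmbient (u n) ∧
      ‖a‖ + ‖b‖ < ‖u n‖ + (1 / 2 : ℝ) ^ n := fun n =>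
    C.exists_decomposition_lt (lt_add_of_pos_right _ (by positivity))
  choose a b hab hlt using key
  have hs : Summable fun n => ‖u n‖ + (1 / 2 : ℝ) ^ n := hu.add summable_geometric_two
  have ha : Summable a := Summable.of_norm_bounded hs
    (fun n => by linarith [hlt n, norm_nonneg (b n)])
  have hb : Summable b := Summable.of_norm_bounded hs
    (fun n => by linarith [hlt n, norm_nonneg (a n)])
  have hu' : u = fun n => C.incl₀ (a n) + C.incl₁ (b n) := by
    funext n
    exact C.toAmbient_injective (by simp [hab])
  refine ⟨C.incl₀ (∑' n, a n) + C.incl₁ (∑' n, b n), ?_⟩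
  rw [hu']
  exact ((ha.hasSum.mapL C.incl₀).add (hb.hasSum.mapL C.incl₁)).tendsto_sum_nat

/-! ### Space-generating functions -/

namespace SpaceGeneratingFunction

variable {C : BanachCouple B₀ B₁ V}

theorem fnorm_eq (f : C.SpaceGeneratingFunction) : f.fnorm = max ‖f.trace₀‖ ‖f.trace₁‖ := by
  rw [ZeroAtInftyContinuousMap.norm_eq_iSup, ZeroAtInftyContinuousMap.norm_eq_iSup]; rfl

theorem fnorm_nonneg (f : C.SpaceGeneratingFunction) : 0 ≤ f.fnorm := by
  rw [fnorm_eq]; exact le_max_of_le_left (norm_nonneg _)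

theorem norm_trace₀_le (f : C.SpaceGeneratingFunction) (y : ℝ) : ‖f.trace₀ y‖ ≤ f.fnorm := by
  rw [fnorm_eq]; exact (f.trace₀.norm_apply_le y).trans (le_max_left _ _)

theorem norm_trace₁_le (f : C.SpaceGeneratingFunction) (y : ℝ) : ‖f.trace₁ y‖ ≤ f.fnorm := by
  rw [fnorm_eq]; exact (f.trace₁.norm_apply_le y).trans (le_max_right _ _)

theorem fnorm_le (f : C.SpaceGeneratingFunction) {M : ℝ} (h₀ : ∀ y, ‖f.trace₀ y‖ ≤ M)
    (h₁ : ∀ y, ‖f.trace₁ y‖ ≤ M) : f.fnorm ≤ M :=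
  max_le (ciSup_le h₀) (ciSup_le h₁)

theorem toFun_line₀' (f : C.SpaceGeneratingFunction) (y : ℝ) :
    f.toFun (Complex.I * y) = C.incl₀ (f.trace₀ y) :=
  C.toAmbient_injective (f.toFun_line₀ y)

theorem toFun_line₁' (f : C.SpaceGeneratingFunction) (y : ℝ) :
    f.toFun (1 + Complex.I * y) = C.incl₁ (f.trace₁ y) :=
  C.toAmbient_injective (f.toFun_line₁ y)

/-- The maximum principle: on the strip, a space-generating function is bounded in the norm of
`B₀ + B₁` by its norm. By the Hahn–Banach theorem this follows from the scalar case. -/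
theorem norm_toFun_le (f : C.SpaceGeneratingFunction) {z : ℂ} (hz : z ∈ strip) :
    ‖f.toFun z‖ ≤ f.fnorm := by
  obtain ⟨l, hl, hlz⟩ := exists_dual_vector'' ℂ (f.toFun z)
  have hle : ∀ v, ‖l v‖ ≤ ‖v‖ := fun v => (l.le_opNorm v).trans (by
    simpa using mul_le_mul_of_nonneg_right hl (norm_nonneg v))
  have := norm_le_of_norm_le_on_lines (F := fun z => l (f.toFun z)) (a := f.fnorm) (b := f.fnorm)
    (l.continuous.comp_continuousOn f.continuousOn) (f.holomorphic l)
    (by obtain ⟨M, hM⟩ := f.bounded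
        exact ⟨M, fun w hw => (hle _).trans (hM w hw)⟩)
    (fun y => by
      rw [toFun_line₀']
      exact (hle _).trans ((C.norm_incl₀_le _).trans (f.norm_trace₀_le y)))
    (fun y => by
      rw [toFun_line₁']
      exact (hle _).trans ((C.norm_incl₁_le _).trans (f.norm_trace₁_le y)))
    hz
  rw [← Real.rpow_add_of_nonneg f.fnorm_nonneg (by linarith [hz.2]) hz.1] at this
  simpa [hlz] using this

/-- An absolutely convergent series of space-generating functions converges, uniformly on the
strip, to a space-generating function. -/
theorem exists_tsum (f : ℕ → C.SpaceGeneratingFunction) (hf : Summable fun n => (f n).fnorm) :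
    ∃ F : C.SpaceGeneratingFunction, F.fnorm ≤ ∑' n, (f n).fnorm ∧
      ∀ z ∈ strip, HasSum (fun n => (f n).toFun z) (F.toFun z) := by
  have hs : ∀ z ∈ strip, Summable fun n => (f n).toFun z := fun z hz =>
    Summable.of_norm_bounded hf (fun n => (f n).norm_toFun_le hz)
  have h0 : Summable fun n => ‖(f n).trace₀‖ := hf.of_nonneg_of_le (fun _ => norm_nonneg _)
    (fun n => by rw [fnorm_eq]; exact le_max_left _ _)
  have h1 : Summable fun n => ‖(f n).trace₁‖ := hf.of_nonneg_of_le (fun _ => norm_nonneg _)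
    (fun n => by rw [fnorm_eq]; exact le_max_right _ _)
  refine ⟨{ toFun := fun z => ∑' n, (f n).toFun z
            continuousOn := continuousOn_tsum (fun n => (f n).continuousOn) hf
              (fun n z hz => (f n).norm_toFun_le hz)
            bounded := ⟨∑' n, (f n).fnorm, fun z hz =>
              tsum_of_norm_bounded hf.hasSum (fun n => (f n).norm_toFun_le hz)⟩
            holomorphic := fun l => ?_
            trace₀ := ∑' n, (f n).trace₀
            trace₁ := ∑' n, (f n).trace₁
            toFun_line₀ := fun y => ?_
            toFun_line₁ := fun y => ?_ }, ?_, fun z hz => (hs z hz).hasSum⟩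
  · have := Complex.differentiableOn_tsum_of_summable_norm (hf.mul_left ‖l‖)
      (fun n => (f n).holomorphic l) isOpen_openStrip (fun n z hz => (l.le_opNorm _).trans
        (mul_le_mul_of_nonneg_left ((f n).norm_toFun_le (openStrip_subset_strip hz))
          (norm_nonneg l)))
    exact this.congr fun z hz => l.map_tsum (hs z (openStrip_subset_strip hz))
  · have e : ∑' n, (f n).toFun (Complex.I * y) = C.incl₀ ((∑' n, (f n).trace₀) y) := by
      change _ = C.incl₀ (ZeroAtInftyContinuousMap.evalL y (∑' n, (f n).trace₀))
      rw [ContinuousLinearMap.map_tsum _ h0.of_norm, ContinuousLinearMap.map_tsum]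
      · exact tsum_congr fun n => (f n).toFun_line₀' y
      · exact h0.of_norm.mapL _
    rw [e, toAmbient_incl₀]
  · have e : ∑' n, (f n).toFun (1 + Complex.I * y) = C.incl₁ ((∑' n, (f n).trace₁) y) := by
      change _ = C.incl₁ (ZeroAtInftyContinuousMap.evalL y (∑' n, (f n).trace₁))
      rw [ContinuousLinearMap.map_tsum _ h1.of_norm, ContinuousLinearMap.map_tsum]
      · exact tsum_congr fun n => (f n).toFun_line₁' y
      · exact h1.of_norm.mapL _
    rw [e, toAmbient_incl₁]
  · rw [fnorm_eq]
    refine max_le (tsum_of_norm_bounded hf.hasSum fun n => ?_)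
      (tsum_of_norm_bounded hf.hasSum fun n => ?_)
    · rw [fnorm_eq]; exact le_max_left _ _
    · rw [fnorm_eq]; exact le_max_right _ _

/-- A finite sum `∑ aᵢ(z) bᵢ` with `bᵢ ∈ B₀ ∩ B₁` is a space-generating function if the scalar
functions `aᵢ` are entire, bounded on the strip, and tend to zero along the two boundary lines. -/
theorem exists_finsetSum {ι : Type*} (s : Finset ι) (a : ι → ℂ → ℂ) (b₀ : ι → B₀) (b₁ : ι → B₁)
    (hb : ∀ i ∈ s, C.emb₀ (b₀ i) = C.emb₁ (b₁ i))
    (ha : ∀ i ∈ s, Differentiable ℂ (a i)) (hbd : ∀ i ∈ s, ∃ M : ℝ, ∀ z ∈ strip, ‖a i z‖ ≤ M)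
    (h₀ : ∀ i ∈ s, Filter.Tendsto (fun y : ℝ => a i (Complex.I * y)) (Filter.cocompact ℝ) (𝓝 0))
    (h₁ : ∀ i ∈ s,
      Filter.Tendsto (fun y : ℝ => a i (1 + Complex.I * y)) (Filter.cocompact ℝ) (𝓝 0)) :
    ∃ F : C.SpaceGeneratingFunction,
      (∀ z, C.toAmbient (F.toFun z) = C.emb₀ (∑ i ∈ s, a i z • b₀ i)) ∧
      (∀ y : ℝ, F.trace₀ y = ∑ i ∈ s, a i (Complex.I * y) • b₀ i) ∧
      (∀ y : ℝ, F.trace₁ y = ∑ i ∈ s, a i (1 + Complex.I * y) • b₁ i) := by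
  have hc : ∀ i ∈ s, Continuous (a i) := fun i hi => (ha i hi).continuous
  refine ⟨{ toFun := fun z => C.incl₀ (∑ i ∈ s, a i z • b₀ i)
            continuousOn := (C.incl₀.continuous.comp (continuous_finsetSum _ fun i hi =>
              (hc i hi).smul continuous_const)).continuousOn
            bounded := ?_
            holomorphic := fun l => ?_
            trace₀ := ⟨⟨fun y => ∑ i ∈ s, a i (Complex.I * y) • b₀ i,
              continuous_finsetSum _ fun i hi =>
                ((hc i hi).comp (by fun_prop)).smul continuous_const⟩, ?_⟩
            trace₁ := ⟨⟨fun y => ∑ i ∈ s, a i (1 + Complex.I * y) • b₁ i,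
              continuous_finsetSum _ fun i hi =>
                ((hc i hi).comp (by fun_prop)).smul continuous_const⟩, ?_⟩
            toFun_line₀ := fun y => rfl
            toFun_line₁ := fun y => ?_ }, fun z => rfl, fun y => rfl, fun y => rfl⟩
  · choose! M hM using hbd
    refine ⟨∑ i ∈ s, M i * ‖b₀ i‖, fun z hz => (C.norm_incl₀_le _).trans
      (norm_sum_le_of_le _ fun i hi => ?_)⟩
    rw [norm_smul]
    exact mul_le_mul_of_nonneg_right (hM i hi z hz) (norm_nonneg _)
  · simp only [map_sum, map_smul, smul_eq_mul]
    exact DifferentiableOn.fun_sum fun i hi => ((ha i hi).mul_const _).differentiableOn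
  · simpa using tendsto_finsetSum s fun i hi => (h₀ i hi).smul_const (b₀ i)
  · simpa using tendsto_finsetSum s fun i hi => (h₁ i hi).smul_const (b₁ i)
  · change C.emb₀ (∑ i ∈ s, a i (1 + Complex.I * y) • b₀ i) =
      C.emb₁ (∑ i ∈ s, a i (1 + Complex.I * y) • b₁ i)
    rw [map_sum, map_sum]
    refine Finset.sum_congr rfl fun i hi => ?_
    rw [map_smul, map_smul, hb i hi]

end SpaceGeneratingFunction

end BanachCouple

/-! ### Scalar coefficients with Gaussian decay -/

/-- The entire function `κ exp(ε (z² - θ²) + α ((1 - z) u₀ + z u₁))`. For `α = log h` this is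
`κ h ^ ((1 - z) u₀ + z u₁)` times a Gaussian factor that equals one at `θ` and makes the function
decay along vertical lines. -/
noncomputable def gaussCoeff (ε θ u₀ u₁ α : ℝ) (κ z : ℂ) : ℂ :=
  κ * Complex.exp (ε * (z ^ 2 - θ ^ 2) + α * ((1 - z) * u₀ + z * u₁))

section gaussCoeff

variable (ε θ u₀ u₁ α : ℝ) (κ : ℂ)

theorem norm_gaussCoeff (z : ℂ) : ‖gaussCoeff ε θ u₀ u₁ α κ z‖ = ‖κ‖ *
    Real.exp (ε * (z.re ^ 2 - z.im ^ 2 - θ ^ 2) + α * ((1 - z.re) * u₀ + z.re * u₁)) := by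
  rw [gaussCoeff, norm_mul, Complex.norm_exp]
  congr 2
  simp [pow_two]

theorem differentiable_gaussCoeff : Differentiable ℂ (gaussCoeff ε θ u₀ u₁ α κ) := by
  unfold gaussCoeff; fun_prop

variable {ε}

theorem gaussCoeff_bounded (hε : 0 < ε) :
    ∃ M : ℝ, ∀ z ∈ BanachCouple.strip, ‖gaussCoeff ε θ u₀ u₁ α κ z‖ ≤ M := by
  refine ⟨‖κ‖ * Real.exp (ε + |α| * (|u₀| + |u₁|)), fun z hz => ?_⟩
  rw [norm_gaussCoeff]
  obtain ⟨h0, h1⟩ := hz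
  have h2 : z.re ^ 2 ≤ 1 := pow_le_one₀ h0 h1
  have h3 : (1 - z.re) * |u₀| ≤ |u₀| := mul_le_of_le_one_left (abs_nonneg _) (by linarith)
  have h4 : z.re * |u₁| ≤ |u₁| := mul_le_of_le_one_left (abs_nonneg _) h1
  have h5 : |(1 - z.re) * u₀ + z.re * u₁| ≤ |u₀| + |u₁| := by
    refine (abs_add_le _ _).trans ?_
    rw [abs_mul, abs_mul, abs_of_nonneg h0, abs_of_nonneg (by linarith : 0 ≤ 1 - z.re)]
    exact add_le_add h3 h4
  refine mul_le_mul_of_nonneg_left (Real.exp_le_exp.2 (add_le_add ?_ ?_)) (norm_nonneg κ)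
  · nlinarith [sq_nonneg z.im, sq_nonneg θ]
  · refine (le_abs_self _).trans ?_
    rw [abs_mul]
    exact mul_le_mul_of_nonneg_left h5 (abs_nonneg α)

theorem tendsto_gaussCoeff_line (hε : 0 < ε) (x : ℝ) :
    Filter.Tendsto (fun y : ℝ => gaussCoeff ε θ u₀ u₁ α κ (x + Complex.I * y))
      (Filter.cocompact ℝ) (𝓝 0) := by
  rw [tendsto_zero_iff_norm_tendsto_zero]
  simp only [norm_gaussCoeff]
  have h1 : Filter.Tendsto (fun y : ℝ => y ^ 2) (Filter.cocompact ℝ) Filter.atTop := by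
    have := (Filter.tendsto_pow_atTop (α := ℝ) two_ne_zero).comp
      (tendsto_norm_cocompact_atTop (E := ℝ))
    refine this.congr fun y => by simp
  have h2 : Filter.Tendsto (fun y : ℝ => ε * (x ^ 2 - y ^ 2 - θ ^ 2) +
      α * ((1 - x) * u₀ + x * u₁)) (Filter.cocompact ℝ) Filter.atBot := by
    have := Filter.tendsto_atBot_add_const_right _ (ε * (x ^ 2 - θ ^ 2) +
      α * ((1 - x) * u₀ + x * u₁)) (Filter.tendsto_neg_atTop_atBot.comp (h1.const_mul_atTop hε))
    refine this.congr fun y => ?_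
    simp only [Function.comp]
    ring
  simpa using (Real.tendsto_exp_atBot.comp h2).const_mul ‖κ‖

theorem norm_gaussCoeff_line_zero_le (hε : 0 < ε) (y : ℝ) :
    ‖gaussCoeff ε θ u₀ u₁ α κ (Complex.I * y)‖ ≤ Real.exp ε * ‖κ‖ * Real.exp (α * u₀) := by
  rw [norm_gaussCoeff, mul_comm (Real.exp ε), mul_assoc, ← Real.exp_add]
  refine mul_le_mul_of_nonneg_left (Real.exp_le_exp.2 (add_le_add ?_ ?_)) (norm_nonneg κ)
  · simp
    nlinarith [mul_nonneg hε.le (sq_nonneg y), mul_nonneg hε.le (sq_nonneg θ)]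
  · simp

theorem norm_gaussCoeff_line_one_le (hε : 0 < ε) (y : ℝ) :
    ‖gaussCoeff ε θ u₀ u₁ α κ (1 + Complex.I * y)‖ ≤
      Real.exp ε * ‖κ‖ * Real.exp (α * u₁) := by
  rw [norm_gaussCoeff, mul_comm (Real.exp ε), mul_assoc, ← Real.exp_add]
  refine mul_le_mul_of_nonneg_left (Real.exp_le_exp.2 (add_le_add ?_ ?_)) (norm_nonneg κ)
  · simp
    nlinarith [mul_nonneg hε.le (sq_nonneg y), mul_nonneg hε.le (sq_nonneg θ)]
  · simp

end gaussCoeff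

/-! ### Norm estimates for powers -/

/-- If `∫ H ≤ 1` then `H ^ (1 / p)` has norm at most one in `L^p`, including `p = ∞`. -/
theorem eLpNorm_le_of_enorm_le_mul_rpow {α : Type*} [MeasurableSpace α] {μ : Measure α}
    {p : ℝ≥0∞} (hp : 1 ≤ p) {g : α → ℂ} {H : α → ℝ≥0∞} {K : ℝ≥0∞} (hK : K ≠ ∞)
    (hg : ∀ᵐ x ∂μ, ‖g x‖ₑ ≤ K * H x ^ (p⁻¹).toReal) (hH : ∫⁻ x, H x ∂μ ≤ 1) :
    eLpNorm g p μ ≤ K := by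
  rcases eq_or_ne p ∞ with rfl | hp'
  · rw [eLpNorm_exponent_top]
    exact eLpNormEssSup_le_of_ae_enorm_bound (by simpa using hg)
  have hp0 : 0 < p.toReal := ENNReal.toReal_pos (zero_lt_one.trans_le hp).ne' hp'
  rw [eLpNorm_eq_lintegral_rpow_enorm_toReal (zero_lt_one.trans_le hp).ne' hp']
  calc (∫⁻ x, ‖g x‖ₑ ^ p.toReal ∂μ) ^ (1 / p.toReal)
      ≤ (∫⁻ x, K ^ p.toReal * H x ∂μ) ^ (1 / p.toReal) := by
        refine ENNReal.rpow_le_rpow (lintegral_mono_ae ?_) (by positivity)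
        filter_upwards [hg] with x hx
        refine (ENNReal.rpow_le_rpow hx hp0.le).trans ?_
        rw [ENNReal.mul_rpow_of_nonneg _ _ hp0.le, ← ENNReal.rpow_mul, ENNReal.toReal_inv,
          inv_mul_cancel₀ hp0.ne', ENNReal.rpow_one]
    _ ≤ (K ^ p.toReal * 1) ^ (1 / p.toReal) := by
        rw [lintegral_const_mul' _ _ (ENNReal.rpow_ne_top_of_nonneg hp0.le hK)]
        gcongr
    _ = K := by
        rw [mul_one, ← ENNReal.rpow_mul, mul_one_div_cancel hp0.ne', ENNReal.rpow_one]

/-- A linear combination of the indicators of the nonzero level sets of a simple function `φ`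
is a composition with `φ`. -/
theorem coeFn_sum_smul_indicatorConstLp {α : Type*} [MeasurableSpace α] {μ : Measure α}
    (p : ℝ≥0∞) (φ : SimpleFunc α ℂ)
    (h : ∀ c : (φ.range.filter (· ≠ 0) : Finset ℂ), μ (φ ⁻¹' {c.1}) ≠ ∞)
    (a : ℂ → ℂ) (ha : a 0 = 0) :
    ⇑(∑ c : (φ.range.filter (· ≠ 0) : Finset ℂ), a c •
      (indicatorConstLp p (φ.measurableSet_fiber c.1) (h c) (1 : ℂ))) =ᵐ[μ]
      fun x => a (φ x) := by
  refine (Lp.coeFn_fun_finsetSum _ _).trans ?_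
  have h1 : ∀ᵐ x ∂μ, ∀ c : (φ.range.filter (· ≠ 0) : Finset ℂ),
      (a c • (indicatorConstLp p (φ.measurableSet_fiber c.1) (h c) (1 : ℂ)) : Lp ℂ p μ) x =
        a c * (φ ⁻¹' {c.1}).indicator (fun _ => (1 : ℂ)) x := by
    rw [ae_all_iff]
    intro c
    filter_upwards [Lp.coeFn_smul (a c) (indicatorConstLp p (φ.measurableSet_fiber c.1) (h c)
      (1 : ℂ)), indicatorConstLp_coeFn (p := p) (hs := φ.measurableSet_fiber c.1) (hμs := h c)
      (c := (1 : ℂ))] with x hx1 hx2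
    rw [hx1, Pi.smul_apply, hx2, smul_eq_mul]
  filter_upwards [h1] with x hx
  simp only [hx]
  rw [Finset.sum_coe_sort (φ.range.filter (· ≠ 0))
    (fun c => a c * (φ ⁻¹' {c}).indicator (fun _ => (1 : ℂ)) x)]
  by_cases h0 : φ x = 0
  · rw [h0, ha]
    refine Finset.sum_eq_zero fun c hc => ?_
    have : φ x ≠ c := by rw [h0]; exact (Finset.mem_filter.1 hc).2.symm
    simp [this]
  · rw [Finset.sum_eq_single (φ x)]
    · simp
    · intro c _ hc
      simp [hc.symm]
    · intro hn
      exact absurd (Finset.mem_filter.2 ⟨φ.mem_range_self x, h0⟩) hn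

/-! ### `L^{p_θ}` is contained in the interpolation space -/

theorem gaussCoeff_self (ε θ u₀ u₁ α : ℝ) (κ : ℂ) :
    gaussCoeff ε θ u₀ u₁ α κ θ = κ * Real.exp (α * ((1 - θ) * u₀ + θ * u₁)) := by
  simp [gaussCoeff]

/-- The normalized density `(|φ| / ‖φ‖_p) ^ p` has integral one. -/
theorem lintegral_ofReal_div_rpow {α : Type*} [MeasurableSpace α] {μ : Measure α} {p : ℝ≥0∞}
    (hp : 1 ≤ p) (hp' : p ≠ ∞) {φ : α → ℂ}
    (hN : 0 < (eLpNorm φ p μ).toReal) :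
    ∫⁻ x, ENNReal.ofReal ((‖φ x‖ / (eLpNorm φ p μ).toReal) ^ p.toReal) ∂μ = 1 := by
  have hp0 : 0 < p.toReal := ENNReal.toReal_pos (zero_lt_one.trans_le hp).ne' hp'
  obtain ⟨hN0, hNt⟩ := ENNReal.toReal_pos_iff.1 hN
  set N := eLpNorm φ p μ with hNdef
  have e : ∀ x, ENNReal.ofReal ((‖φ x‖ / N.toReal) ^ p.toReal) =
      (N ^ p.toReal)⁻¹ * ‖φ x‖ₑ ^ p.toReal := by
    intro x
    rw [← ENNReal.ofReal_rpow_of_nonneg (by positivity) hp0.le, ENNReal.ofReal_div_of_pos hN,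
      ENNReal.ofReal_toReal hNt.ne, ofReal_norm, ENNReal.div_rpow_of_nonneg _ _ hp0.le,
      div_eq_mul_inv, mul_comm]
  simp only [e]
  have hfin : N ^ p.toReal ≠ ∞ := ENNReal.rpow_ne_top_of_nonneg hp0.le hNt.ne
  have hne : N ^ p.toReal ≠ 0 := by
    simp [ENNReal.rpow_eq_zero_iff, hN0.ne', hp0.not_gt]
  have hint : ∫⁻ x, ‖φ x‖ₑ ^ p.toReal ∂μ = N ^ p.toReal := by
    rw [hNdef, eLpNorm_eq_lintegral_rpow_enorm_toReal (zero_lt_one.trans_le hp).ne' hp',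
      ← ENNReal.rpow_mul, one_div_mul_cancel hp0.ne', ENNReal.rpow_one]
  rw [lintegral_const_mul' _ _ (ENNReal.inv_ne_top.2 hne), hint, ENNReal.inv_mul_cancel hne hfin]

section

variable {d : ℕ} {p₀ p₁ pθ : ℝ≥0∞} [Fact (1 ≤ p₀)] [Fact (1 ≤ p₁)] [Fact (1 ≤ pθ)] {θ : ℝ}

/-- The space-generating function
`f(z) = exp(ε (z² - θ²)) ‖φ‖ sgn φ (|φ| / ‖φ‖) ^ (p_θ ((1 - z) / p₀ + z / p₁))`
of a simple function `φ`. It is a finite sum because `φ` takes finitely many values. -/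
theorem exists_spaceGeneratingFunction_simpleFunc (hθ : (pθ⁻¹).toReal =
    (1 - θ) * (p₀⁻¹).toReal + θ * (p₁⁻¹).toReal) (hpt : pθ ≠ ∞)
    (φ : SimpleFunc (EuclideanSpace ℝ (Fin d)) ℂ) (hφ : MemLp φ pθ volume) {ε : ℝ} (hε : 0 < ε) :
    ∃ F : (lpCouple d p₀ p₁).SpaceGeneratingFunction,
      (lpCouple d p₀ p₁).toAmbient (F.toFun θ) = lpInclusion d pθ (hφ.toLp φ) ∧
      F.fnorm ≤ Real.exp ε * ‖hφ.toLp φ‖ := by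
  have h1 : (1 : ℝ≥0∞) ≤ pθ := Fact.out
  have hp0 : 0 < pθ.toReal := ENNReal.toReal_pos (zero_lt_one.trans_le h1).ne' hpt
  rw [Lp.norm_toLp]
  set N := (eLpNorm φ pθ volume).toReal with hN
  have hNn : 0 ≤ N := ENNReal.toReal_nonneg
  rcases hNn.eq_or_lt with hN0 | hN0
  -- the formula divides by `‖φ‖`; for `‖φ‖ = 0` the zero function generates the class of `φ`
  · obtain ⟨F, hF, hF0, hF1⟩ :=
      BanachCouple.SpaceGeneratingFunction.exists_finsetSum (C := lpCouple d p₀ p₁)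
        (∅ : Finset ℕ) (fun _ _ => 0) (fun _ => 0) (fun _ => 0) (by simp) (by simp) (by simp)
        (by simp) (by simp)
    refine ⟨F, ?_, F.fnorm_le (fun y => by simp [hF0, ← hN0]) (fun y => by simp [hF1, ← hN0])⟩
    have : hφ.toLp φ = 0 := by
      rw [← norm_eq_zero, Lp.norm_toLp, ← hN, ← hN0]
    rw [hF, this]
    simp
  have hm : ∀ c : (φ.range.filter (· ≠ 0) : Finset ℂ),
      (volume : Measure (EuclideanSpace ℝ (Fin d))) (φ ⁻¹' {c.1}) ≠ ∞ := fun c =>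
    (SimpleFunc.measure_preimage_lt_top_of_memLp (zero_lt_one.trans_le h1).ne' hpt φ hφ c.1
      (Finset.mem_filter.1 c.2).2).ne
  -- the value of the formula at a point where `φ` equals `c`; it vanishes for `c = 0`
  set a : ℂ → ℂ → ℂ := fun c => gaussCoeff ε θ (p₀⁻¹).toReal (p₁⁻¹).toReal
    (Real.log (‖c‖ / N) * pθ.toReal) (N * (c / ‖c‖)) with ha
  have ha0 : ∀ z, a 0 z = 0 := fun z => by simp [ha, gaussCoeff]
  obtain ⟨F, hF, hF0, hF1⟩ :=
    BanachCouple.SpaceGeneratingFunction.exists_finsetSum (C := lpCouple d p₀ p₁)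
      (Finset.univ : Finset (φ.range.filter (· ≠ 0) : Finset ℂ)) (fun c => a c)
      (fun c => indicatorConstLp p₀ (φ.measurableSet_fiber c.1) (hm c) (1 : ℂ))
      (fun c => indicatorConstLp p₁ (φ.measurableSet_fiber c.1) (hm c) (1 : ℂ))
      (fun c _ => rfl) (fun c _ => differentiable_gaussCoeff _ _ _ _ _ _)
      (fun c _ => gaussCoeff_bounded _ _ _ _ _ hε)
      (fun c _ => by simpa using tendsto_gaussCoeff_line _ _ _ _ _ hε 0)
      (fun c _ => by simpa using tendsto_gaussCoeff_line _ _ _ _ _ hε 1)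
  -- the bound on both boundary lines
  have key : ∀ (p : ℝ≥0∞), 1 ≤ p → ∀ b : ℂ → ℂ,
      (∀ c, ‖b c‖ ≤ Real.exp ε * ‖(N * (c / ‖c‖) : ℂ)‖ *
        Real.exp (Real.log (‖c‖ / N) * pθ.toReal * (p⁻¹).toReal)) →
      eLpNorm (fun x => b (φ x)) p volume ≤ ENNReal.ofReal (Real.exp ε * N) := by
    intro p hp b hb
    refine eLpNorm_le_of_enorm_le_mul_rpow hp ENNReal.ofReal_ne_top
      (H := fun x => ENNReal.ofReal ((‖φ x‖ / N) ^ pθ.toReal)) ?_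
      (lintegral_ofReal_div_rpow h1 hpt hN0).le
    refine Filter.Eventually.of_forall fun x => ?_
    rw [ENNReal.ofReal_rpow_of_nonneg (by positivity) ENNReal.toReal_nonneg,
      ← ENNReal.ofReal_mul (by positivity), ← ofReal_norm]
    refine ENNReal.ofReal_le_ofReal ((hb _).trans ?_)
    rcases eq_or_ne (φ x) 0 with h0 | h0
    · rw [h0]
      simp only [norm_zero, zero_div, mul_zero, zero_mul]
      positivity
    · have hpos : 0 < ‖φ x‖ := norm_pos_iff.2 h0
      have e1 : ‖(N * (φ x / ‖φ x‖) : ℂ)‖ = N := by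
        simp [abs_of_pos hN0, hpos.ne']
      rw [e1, ← Real.rpow_mul (by positivity), Real.rpow_def_of_pos (by positivity),
        mul_assoc, mul_assoc, mul_assoc]
  refine ⟨F, ?_, F.fnorm_le (fun y => ?_) (fun y => ?_)⟩
  · rw [hF]
    refine Subtype.ext (AEEqFun.ext ?_)
    refine (coeFn_sum_smul_indicatorConstLp p₀ φ hm (fun c => a c θ) (ha0 _)).trans
      (Filter.EventuallyEq.trans ?_ hφ.coeFn_toLp.symm)
    refine Filter.Eventually.of_forall fun x => ?_
    rcases eq_or_ne (φ x) 0 with h0 | h0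
    · simp only [h0, ha0]
    · have hpos : 0 < ‖φ x‖ := norm_pos_iff.2 h0
      have e2 : pθ.toReal * ((1 - θ) * (p₀⁻¹).toReal + θ * (p₁⁻¹).toReal) = 1 := by
        rw [← hθ, ENNReal.toReal_inv, mul_inv_cancel₀ hp0.ne']
      simp only [ha]
      rw [gaussCoeff_self, mul_assoc (Real.log _), e2, mul_one, Real.exp_log (by positivity)]
      have : (N : ℂ) ≠ 0 := by exact_mod_cast hN0.ne'
      have : (‖φ x‖ : ℂ) ≠ 0 := by exact_mod_cast hpos.ne'
      push_cast
      field_simp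
  · rw [hF0, Lp.norm_def, eLpNorm_congr_ae (coeFn_sum_smul_indicatorConstLp p₀ φ hm
      (fun c => a c (Complex.I * y)) (ha0 _))]
    exact ENNReal.toReal_le_of_le_ofReal (by positivity) (key p₀ Fact.out
      (fun c => a c (Complex.I * y)) fun c => norm_gaussCoeff_line_zero_le _ _ _ _ _ hε y)
  · rw [hF1, Lp.norm_def, eLpNorm_congr_ae (coeFn_sum_smul_indicatorConstLp p₁ φ hm
      (fun c => a c (1 + Complex.I * y)) (ha0 _))]
    exact ENNReal.toReal_le_of_le_ofReal (by positivity) (key p₁ Fact.out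
      (fun c => a c (1 + Complex.I * y)) fun c => norm_gaussCoeff_line_one_le _ _ _ _ _ hε y)

/-- For `p_θ < ∞` a general `v` is a rapidly convergent series of simple functions, and the
series of their space-generating functions converges. -/
theorem exists_spaceGeneratingFunction_of_ne_top (h01 : θ ∈ Ioo (0 : ℝ) 1) (hθ : (pθ⁻¹).toReal =
    (1 - θ) * (p₀⁻¹).toReal + θ * (p₁⁻¹).toReal) (hpt : pθ ≠ ∞)
    (v : Lp ℂ pθ (volume : Measure (EuclideanSpace ℝ (Fin d)))) {ε : ℝ} (hε : 0 < ε) :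
    ∃ F : (lpCouple d p₀ p₁).SpaceGeneratingFunction,
      (lpCouple d p₀ p₁).toAmbient (F.toFun θ) = lpInclusion d pθ v ∧
      F.fnorm ≤ Real.exp ε * (‖v‖ + 2 * ε) := by
  obtain ⟨w, hw, hws, hw0, hwn⟩ := controlled_sum_of_mem_closure
    (s := Lp.simpleFunc ℂ pθ (volume : Measure (EuclideanSpace ℝ (Fin d))))
    (Lp.simpleFunc.dense hpt v) (b := fun n => ε * (1 / 2) ^ n) (fun n => by positivity)
  have hf : ∀ n, ∃ F : (lpCouple d p₀ p₁).SpaceGeneratingFunction,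
      (lpCouple d p₀ p₁).toAmbient (F.toFun θ) = lpInclusion d pθ (w n) ∧
      F.fnorm ≤ Real.exp ε * ‖w n‖ := by
    intro n
    have := exists_spaceGeneratingFunction_simpleFunc hθ hpt
      (Lp.simpleFunc.toSimpleFunc ⟨w n, hws n⟩) (Lp.simpleFunc.memLp ⟨w n, hws n⟩) hε
    rwa [show MemLp.toLp _ (Lp.simpleFunc.memLp ⟨w n, hws n⟩) = w n from
      congrArg Subtype.val (Lp.simpleFunc.toLp_toSimpleFunc ⟨w n, hws n⟩)] at this
  choose f hfw hfn using hf
  have hwle : ∀ n, ‖w n‖ ≤ ε * (1 / 2) ^ n + (if n = 0 then ‖v‖ else 0) := by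
    intro n
    rcases Nat.eq_zero_or_pos n with rfl | hn
    · have : ‖w 0‖ ≤ ‖-w 0 + v‖ + ‖v‖ := by
        calc ‖w 0‖ = ‖-(-w 0 + v) + v‖ := by congr 1; abel
          _ ≤ _ := (norm_add_le _ _).trans (by rw [norm_neg])
      simp only [if_true]
      linarith
    · simp only [hn.ne', if_false, add_zero]
      exact (hwn n hn).le
  have hsum : HasSum (fun n : ℕ => Real.exp ε * (ε * (1 / 2) ^ n + (if n = 0 then ‖v‖ else 0)))
      (Real.exp ε * (ε * 2 + ‖v‖)) :=
    ((hasSum_geometric_two.mul_left ε).add (hasSum_ite_eq 0 ‖v‖)).mul_left _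
  have hle : ∀ n, (f n).fnorm ≤
      Real.exp ε * (ε * (1 / 2) ^ n + (if n = 0 then ‖v‖ else 0)) := fun n =>
    (hfn n).trans (mul_le_mul_of_nonneg_left (hwle n) (Real.exp_pos _).le)
  have hfs : Summable fun n => (f n).fnorm :=
    hsum.summable.of_nonneg_of_le (fun n => (f n).fnorm_nonneg) hle
  obtain ⟨F, hF, hFs⟩ := BanachCouple.SpaceGeneratingFunction.exists_tsum f hfs
  refine ⟨F, ?_, hF.trans ((hfs.tsum_le_tsum hle hsum.summable).trans
    (by rw [hsum.tsum_eq, add_comm ‖v‖, mul_comm 2]))⟩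
  have hmem : (θ : ℂ) ∈ BanachCouple.strip := by
    simp [BanachCouple.strip, h01.1.le, h01.2.le]
  have t1 := (((hFs θ hmem).mapL (lpCouple d p₀ p₁).toAmbientL).tendsto_sum_nat).comp
    (Filter.tendsto_add_atTop_nat 1)
  have t2 := ((lpInclusion d pθ).continuous.tendsto v).comp hw
  refine tendsto_nhds_unique t1 (t2.congr fun n => ?_)
  simp only [Function.comp, map_sum]
  exact Finset.sum_congr rfl fun i _ => (hfw i).symm

/-- For `p₀ = p₁ = ∞` the function `exp(ε (z² - θ²)) v` generates `v`. -/
theorem exists_spaceGeneratingFunction_top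
    (v : Lp ℂ ∞ (volume : Measure (EuclideanSpace ℝ (Fin d)))) {ε : ℝ} (hε : 0 < ε) :
    ∃ F : (lpCouple d ∞ ∞).SpaceGeneratingFunction,
      (lpCouple d ∞ ∞).toAmbient (F.toFun θ) = lpInclusion d ∞ v ∧
      F.fnorm ≤ Real.exp ε * ‖v‖ := by
  obtain ⟨F, hF, hF0, hF1⟩ :=
    BanachCouple.SpaceGeneratingFunction.exists_finsetSum (C := lpCouple d ∞ ∞)
      (Finset.univ : Finset Unit) (fun _ => gaussCoeff ε θ 0 0 0 1) (fun _ => v) (fun _ => v)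
      (fun c _ => rfl) (fun c _ => differentiable_gaussCoeff _ _ _ _ _ _)
      (fun c _ => gaussCoeff_bounded _ _ _ _ _ hε)
      (fun c _ => by simpa using tendsto_gaussCoeff_line _ _ _ _ _ hε 0)
      (fun c _ => by simpa using tendsto_gaussCoeff_line _ _ _ _ _ hε 1)
  refine ⟨F, ?_, F.fnorm_le (fun y => ?_) (fun y => ?_)⟩
  · rw [hF]
    simp only [gaussCoeff_self]
    simp
    rfl
  · rw [hF0]
    simp only [Finset.univ_unique, Finset.sum_singleton, norm_smul]
    gcongr
    simpa using norm_gaussCoeff_line_zero_le θ 0 0 0 1 hε y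
  · rw [hF1]
    simp only [Finset.univ_unique, Finset.sum_singleton, norm_smul]
    gcongr
    simpa using norm_gaussCoeff_line_one_le θ 0 0 0 1 hε y

end

/-! ### The interpolation space is contained in `L^{p_θ}` -/

/-- Hölder's inequality against a step function: with `G = ∑ hᵢ 1_{Eᵢ}` this bounds
`∫ |g| G ^ (1 - 1 / p)` by `‖g‖_p (∫ G) ^ (1 - 1 / p)`. -/
theorem sum_rpow_mul_lintegral_le {α ι : Type*} [MeasurableSpace α] {μ : Measure α} {p : ℝ≥0∞}
    (hp : 1 ≤ p) {g : α → ℂ} (hg : AEStronglyMeasurable g μ) (s : Finset ι) {E : ι → Set α}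
    (hE : ∀ i ∈ s, MeasurableSet (E i)) (hd : (s : Set ι).PairwiseDisjoint E) (h : ι → ℝ≥0∞) :
    ∑ i ∈ s, h i ^ (1 - (p⁻¹).toReal) * ∫⁻ x in E i, ‖g x‖ₑ ∂μ ≤
      eLpNorm g p μ * (∑ i ∈ s, h i * μ (E i)) ^ (1 - (p⁻¹).toReal) := by
  have hu : 0 ≤ 1 - (p⁻¹).toReal := by
    have := ENNReal.toReal_mono ENNReal.one_ne_top (ENNReal.inv_le_one.2 hp)
    simpa using this
  have h1 : ∀ i, ∫⁻ x in E i, ‖g x‖ₑ ∂μ ≤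
      eLpNorm g p (μ.restrict (E i)) * μ (E i) ^ (1 - (p⁻¹).toReal) := by
    intro i
    have := eLpNorm_le_eLpNorm_mul_rpow_measure_univ hp (hg.restrict (s := E i))
    rwa [eLpNorm_one_eq_lintegral_enorm, Measure.restrict_apply_univ, ENNReal.toReal_one, div_one,
      one_div, ← ENNReal.toReal_inv] at this
  have h2 : ∑ i ∈ s, h i ^ (1 - (p⁻¹).toReal) * ∫⁻ x in E i, ‖g x‖ₑ ∂μ ≤
      ∑ i ∈ s, eLpNorm g p (μ.restrict (E i)) * (h i * μ (E i)) ^ (1 - (p⁻¹).toReal) := by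
    refine Finset.sum_le_sum fun i _ => (mul_le_mul_right (h1 i) _).trans_eq ?_
    rw [ENNReal.mul_rpow_of_nonneg _ _ hu]
    ring
  refine h2.trans ?_
  rcases eq_or_ne p ∞ with rfl | hpt
  · simp only [ENNReal.inv_top, ENNReal.toReal_zero, sub_zero, ENNReal.rpow_one, Finset.mul_sum]
    exact Finset.sum_le_sum fun i _ =>
      mul_le_mul_left (eLpNorm_mono_measure _ Measure.restrict_le_self) _
  rcases hp.eq_or_lt with rfl | hp1
  · simp only [inv_one, ENNReal.toReal_one, sub_self, ENNReal.rpow_zero, mul_one,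
      eLpNorm_one_eq_lintegral_enorm]
    rw [← lintegral_biUnion_finset hd hE]
    exact setLIntegral_le_lintegral _ _
  have hp0 : p ≠ 0 := (zero_lt_one.trans hp1).ne'
  have hq : 1 < p.toReal := by
    simpa using (ENNReal.toReal_lt_toReal ENNReal.one_ne_top hpt).2 hp1
  have hq0 : 0 < p.toReal := by linarith
  have hc := Real.HolderConjugate.conjExponent hq
  have he : 1 - (p⁻¹).toReal = 1 / p.toReal.conjExponent := by
    rw [ENNReal.toReal_inv, one_div, hc.one_sub_inv]
  rw [he]
  refine (ENNReal.inner_le_Lp_mul_Lq s _ _ hc).trans (mul_le_mul' ?_ ?_)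
  · rw [eLpNorm_eq_lintegral_rpow_enorm_toReal hp0 hpt]
    refine ENNReal.rpow_le_rpow ?_ (by positivity)
    simp only [eLpNorm_eq_lintegral_rpow_enorm_toReal hp0 hpt, ← ENNReal.rpow_mul,
      one_div_mul_cancel hq0.ne', ENNReal.rpow_one]
    rw [← lintegral_biUnion_finset hd hE]
    exact setLIntegral_le_lintegral _ _
  · simp only [← ENNReal.rpow_mul, one_div_mul_cancel hc.symm.ne_zero, ENNReal.rpow_one, le_refl]

section

variable {d : ℕ} {p₀ p₁ pθ : ℝ≥0∞} [Fact (1 ≤ p₀)] [Fact (1 ≤ p₁)] [Fact (1 ≤ pθ)] {θ : ℝ}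

/-- Integration over a bounded set against a bounded weight is continuous on `L^1_loc`. -/
theorem L1loc.exists_clm_setIntegral {E : Set (EuclideanSpace ℝ (Fin d))} {n : ℕ}
    (hE : E ⊆ Metric.closedBall 0 (n : ℝ)) {w : EuclideanSpace ℝ (Fin d) → ℂ}
    (hw : Measurable w) (hw1 : ∀ x, ‖w x‖ ≤ 1) :
    ∃ l : L1loc d →L[ℂ] ℂ, ∀ h : L1loc d, l h = ∫ x in E, w x * h.1 x := by
  have hint : ∀ h : L1loc d, IntegrableOn (fun x => w x * h.1 x) E := fun h =>
    ((L1loc.integrableOn h n).mono_set hE).bdd_mul hw.aestronglyMeasurable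
      (Filter.Eventually.of_forall hw1)
  let l : L1loc d →ₗ[ℂ] ℂ :=
    { toFun := fun h => ∫ x in E, w x * h.1 x
      map_add' := fun f g => by
        rw [← integral_add (hint f) (hint g)]
        refine integral_congr_ae ?_
        filter_upwards [ae_restrict_of_ae (AEEqFun.coeFn_add f.1 g.1)] with x hx
        simp only [Submodule.coe_add, hx, Pi.add_apply, mul_add]
      map_smul' := fun c f => by
        rw [RingHom.id_apply, smul_eq_mul, ← integral_const_mul]
        refine integral_congr_ae ?_
        filter_upwards [ae_restrict_of_ae (AEEqFun.coeFn_smul c f.1)] with x hx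
        simp only [Submodule.coe_smul, hx, Pi.smul_apply, smul_eq_mul]
        ring }
  refine ⟨⟨l, L1loc.withSeminorms.continuous_normedSpace_rng ℂ l
    ⟨{n}, 1, fun h => ?_⟩⟩, fun h => rfl⟩
  simp only [Finset.sup_singleton, one_smul]
  change ‖∫ x in E, w x * h.1 x‖ ≤ ∫ x in Metric.closedBall 0 (n : ℝ), ‖h.1 x‖
  calc ‖∫ x in E, w x * h.1 x‖ ≤ ∫ x in E, ‖h.1 x‖ := by
        refine norm_integral_le_of_norm_le ((L1loc.integrableOn h n).mono_set hE).norm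
          (Filter.Eventually.of_forall fun x => ?_)
        rw [norm_mul]
        exact mul_le_of_le_one_left (norm_nonneg _) (hw1 x)
    _ ≤ _ := setIntegral_mono_set (L1loc.integrableOn h n).norm
        (Filter.Eventually.of_forall fun x => norm_nonneg _) hE.eventuallyLE

/-- A measurable choice of the conjugate sign of `v`. -/
theorem exists_conj_sign {α : Type*} [MeasurableSpace α] {v : α → ℂ} (hv : Measurable v) :
    ∃ w : α → ℂ, Measurable w ∧ (∀ x, ‖w x‖ ≤ 1) ∧ ∀ x, w x * v x = (‖v x‖ : ℂ) := by
  refine ⟨fun x => (starRingEnd ℂ) (v x) / ‖v x‖, ?_, fun x => ?_, fun x => ?_⟩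
  · exact (Complex.continuous_conj.measurable.comp hv).div (Complex.measurable_ofReal.comp hv.norm)
  · simp only [norm_div, RCLike.norm_conj, Complex.norm_real, norm_norm]
    exact div_self_le_one _
  · rcases eq_or_ne (v x) 0 with h0 | h0
    · simp [h0]
    · have : (‖v x‖ : ℂ) ≠ 0 := by exact_mod_cast (norm_pos_iff.2 h0).ne'
      rw [div_mul_eq_mul_div, mul_comm, Complex.mul_conj, Complex.normSq_eq_norm_sq]
      push_cast
      field_simp

/-- Hölder's inequality for the function `F` of the three lines estimate on a boundary line, where
the coefficients have modulus `hᵢ ^ (1 - 1 / p)`. -/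
theorem norm_sum_mul_setIntegral_le {α ι : Type*} [MeasurableSpace α] {μ : Measure α} {p : ℝ≥0∞}
    (hp : 1 ≤ p) (g : Lp ℂ p μ) (s : Finset ι) {E : ι → Set α}
    (hE : ∀ i ∈ s, MeasurableSet (E i)) (hfin : ∀ i ∈ s, μ (E i) ≠ ∞)
    (hd : (s : Set ι).PairwiseDisjoint E) {h : ι → ℝ} (hh : ∀ i, 0 < h i)
    (hpos : 0 < ∑ i ∈ s, h i * μ.real (E i)) {w : α → ℂ} (hw1 : ∀ x, ‖w x‖ ≤ 1)
    {b : ι → ℂ} (hb : ∀ i, ‖b i‖ = h i ^ (1 - (p⁻¹).toReal)) :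
    ‖∑ i ∈ s, b i * ∫ x in E i, w x * g x ∂μ‖ ≤
      ‖g‖ * (∑ i ∈ s, h i * μ.real (E i)) ^ (1 - (p⁻¹).toReal) := by
  have hAE : (∑ i ∈ s, ENNReal.ofReal (h i) * μ (E i)) =
      ENNReal.ofReal (∑ i ∈ s, h i * μ.real (E i)) := by
    rw [ENNReal.ofReal_sum_of_nonneg fun i _ => mul_nonneg (hh i).le measureReal_nonneg]
    refine Finset.sum_congr rfl fun i hi => ?_
    rw [ENNReal.ofReal_mul (hh i).le, ofReal_measureReal (hfin i hi)]
  have hE1 : ‖∑ i ∈ s, b i * ∫ x in E i, w x * g x ∂μ‖ₑ ≤ eLpNorm g p μ *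
      ENNReal.ofReal (∑ i ∈ s, h i * μ.real (E i)) ^ (1 - (p⁻¹).toReal) := by
    rw [← hAE]
    refine le_trans ?_ (sum_rpow_mul_lintegral_le hp (Lp.aestronglyMeasurable g) s hE hd _)
    refine (enorm_sum_le _ _).trans (Finset.sum_le_sum fun i hi => ?_)
    rw [enorm_mul]
    refine mul_le_mul' (le_of_eq ?_) ?_
    · rw [← ofReal_norm, hb, ENNReal.ofReal_rpow_of_pos (hh i)]
    · refine (enorm_integral_le_lintegral_enorm _).trans (lintegral_mono fun x => ?_)
      rw [enorm_mul]
      refine mul_le_of_le_one_left' ?_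
      rw [← ofReal_norm]
      exact ENNReal.ofReal_le_one.2 (hw1 x)
  rw [ENNReal.ofReal_rpow_of_pos hpos] at hE1
  have := ENNReal.toReal_mono (ENNReal.mul_ne_top (Lp.eLpNorm_ne_top g) ENNReal.ofReal_ne_top) hE1
  rwa [toReal_enorm, ENNReal.toReal_mul, ENNReal.toReal_ofReal (by positivity)] at this

/-- The three lines estimate. It is applied to `F(z) = ∫ f(z) g_z` with
`g_z = conj (sgn v) ∑ hᵢ ^ (1 - (1 - z) / p₀ - z / p₁) 1_{Eᵢ}` and `v = f(θ)`. -/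
theorem mul_sum_le_fnorm_mul_rpow (h01 : θ ∈ Ioo (0 : ℝ) 1)
    (f : (lpCouple d p₀ p₁).SpaceGeneratingFunction) {ι : Type*} (s : Finset ι)
    {E : ι → Set (EuclideanSpace ℝ (Fin d))} (hE : ∀ i ∈ s, MeasurableSet (E i))
    (hb : ∀ i ∈ s, ∃ n : ℕ, E i ⊆ Metric.closedBall 0 (n : ℝ))
    (hd : (s : Set ι).PairwiseDisjoint E) {h : ι → ℝ} (hh : ∀ i, 0 < h i) {u c : ℝ}
    {v : L1loc d} (hfv : (lpCouple d p₀ p₁).toAmbient (f.toFun θ) = v)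
    (hu : u = (1 - θ) * (p₀⁻¹).toReal + θ * (p₁⁻¹).toReal)
    (hv : ∀ i ∈ s, ∀ x ∈ E i, c * h i ^ u ≤ ‖v.1 x‖) :
    c * ∑ i ∈ s, h i * volume.real (E i) ≤
      f.fnorm * (∑ i ∈ s, h i * volume.real (E i)) ^ (1 - u) := by
  set A := ∑ i ∈ s, h i * volume.real (E i) with hA
  have hA0 : 0 ≤ A := Finset.sum_nonneg fun i _ => mul_nonneg (hh i).le measureReal_nonneg
  rcases hA0.eq_or_lt with h0 | hApos
  · rw [← h0, mul_zero]
    exact mul_nonneg f.fnorm_nonneg (Real.rpow_nonneg le_rfl _)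
  have hfin : ∀ i ∈ s, volume (E i) ≠ ∞ := fun i hi => by
    obtain ⟨n, hn⟩ := hb i hi
    exact ((measure_mono hn).trans_lt measure_closedBall_lt_top).ne
  obtain ⟨w, hwm, hw1, hwv⟩ := exists_conj_sign (AEEqFun.stronglyMeasurable v.1).measurable
  have hl : ∀ i ∈ s, ∃ l : L1loc d →L[ℂ] ℂ, ∀ g : L1loc d, l g = ∫ x in E i, w x * g.1 x :=
    fun i hi => by
      obtain ⟨n, hn⟩ := hb i hi
      exact L1loc.exists_clm_setIntegral hn hwm hw1
  choose! l hl using hl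
  set u₀ := (p₀⁻¹).toReal with hu₀
  set u₁ := (p₁⁻¹).toReal with hu₁
  set a : ι → ℂ → ℂ := fun i z => Complex.exp (Real.log (h i) * (1 - (1 - z) * u₀ - z * u₁))
    with ha
  have had : ∀ i, Differentiable ℂ (a i) := fun i => by simp only [ha]; fun_prop
  have han : ∀ i z, ‖a i z‖ = h i ^ (1 - (1 - z.re) * u₀ - z.re * u₁) := fun i z => by
    simp only [ha, Complex.norm_exp]
    rw [Real.rpow_def_of_pos (hh i)]
    congr 1
    simp
  set F : ℂ → ℂ := fun z => ∑ i ∈ s, a i z * l i ((lpCouple d p₀ p₁).toAmbientL (f.toFun z)) with hF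
  -- Hölder's inequality on the boundary lines
  have hbound : ∀ (p : ℝ≥0∞) [Fact (1 ≤ p)] (g : Lp ℂ p (volume : Measure _)) (z : ℂ),
      (lpCouple d p₀ p₁).toAmbient (f.toFun z) = lpInclusion d p g → ‖g‖ ≤ f.fnorm →
      (1 - z.re) * u₀ + z.re * u₁ = (p⁻¹).toReal →
      ‖F z‖ ≤ f.fnorm * A ^ (1 - (p⁻¹).toReal) := by
    intro p hp g z hz hg hzu
    have hFz : F z = ∑ i ∈ s, a i z * ∫ x in E i, w x * g x := by
      refine Finset.sum_congr rfl fun i hi => ?_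
      rw [BanachCouple.toAmbientL_apply, hz, hl i hi]
      rfl
    rw [hFz]
    refine (norm_sum_mul_setIntegral_le hp.out g s hE hfin hd hh hApos hw1
      (fun i => ?_)).trans (mul_le_mul_of_nonneg_right hg (Real.rpow_nonneg hA0 _))
    rw [han, ← hzu]
    congr 1
    ring
  have hthree := BanachCouple.norm_le_of_norm_le_on_lines (F := F) (z := θ)
    (a := f.fnorm * A ^ (1 - u₀)) (b := f.fnorm * A ^ (1 - u₁))
    (continuousOn_finsetSum _ fun i _ => (had i).continuous.continuousOn.mul
      (((l i).continuous.comp (lpCouple d p₀ p₁).toAmbientL.continuous).comp_continuousOn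
        f.continuousOn))
    (DifferentiableOn.fun_sum fun i _ => (had i).differentiableOn.mul
      (f.holomorphic ((l i).comp (lpCouple d p₀ p₁).toAmbientL)))
    (by
      -- the exponent has real part between `-(u₀ + u₁)` and `1`, and `hᵢ` may lie on either side
      -- of `1`
      refine ⟨∑ i ∈ s, (h i ^ (-(u₀ + u₁) : ℝ) + h i ^ (1 : ℝ)) *
        (‖(l i).comp (lpCouple d p₀ p₁).toAmbientL‖ * f.fnorm), fun z hz => ?_⟩
      refine norm_sum_le_of_le _ fun i _ => ?_
      rw [norm_mul]
      refine mul_le_mul ?_ ?_ (norm_nonneg _) (by have := hh i; positivity)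
      · rw [han]
        have hu0 : 0 ≤ u₀ := ENNReal.toReal_nonneg
        have hu1 : 0 ≤ u₁ := ENNReal.toReal_nonneg
        have e1 : (1 - z.re) * u₀ ≤ u₀ := mul_le_of_le_one_left hu0 (by linarith [hz.1])
        have e2 : z.re * u₁ ≤ u₁ := mul_le_of_le_one_left hu1 hz.2
        have e3 : 0 ≤ (1 - z.re) * u₀ := mul_nonneg (by linarith [hz.2]) hu0
        have e4 : 0 ≤ z.re * u₁ := mul_nonneg hz.1 hu1
        have hp1 := Real.rpow_nonneg (hh i).le (-(u₀ + u₁))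
        have hp2 := Real.rpow_nonneg (hh i).le 1
        rcases le_total 1 (h i) with h1 | h1
        · have := Real.rpow_le_rpow_of_exponent_le h1
            (show 1 - (1 - z.re) * u₀ - z.re * u₁ ≤ 1 by linarith)
          linarith
        · have := Real.rpow_le_rpow_of_exponent_ge (hh i) h1
            (show -(u₀ + u₁) ≤ 1 - (1 - z.re) * u₀ - z.re * u₁ by linarith)
          linarith
      · exact (((l i).comp (lpCouple d p₀ p₁).toAmbientL).le_opNorm _).trans
          (mul_le_mul_of_nonneg_left (f.norm_toFun_le hz) (norm_nonneg _)))
    (fun y => hbound p₀ (f.trace₀ y) _ (f.toFun_line₀ y) (f.norm_trace₀_le y) (by simp [hu₀]))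
    (fun y => hbound p₁ (f.trace₁ y) _ (f.toFun_line₁ y) (f.norm_trace₁_le y) (by simp [hu₁]))
    (by simp [BanachCouple.strip, h01.1.le, h01.2.le])
  have hM := f.fnorm_nonneg
  have hrhs : (f.fnorm * A ^ (1 - u₀)) ^ (1 - (θ : ℂ).re) *
      (f.fnorm * A ^ (1 - u₁)) ^ (θ : ℂ).re =
      f.fnorm * A ^ (1 - u) := by
    rw [Complex.ofReal_re, Real.mul_rpow hM (by positivity), Real.mul_rpow hM (by positivity),
      mul_mul_mul_comm, ← Real.rpow_add_of_nonneg hM (by linarith [h01.2]) h01.1.le,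
      ← Real.rpow_mul hA0, ← Real.rpow_mul hA0, ← Real.rpow_add hApos, hu]
    congr 1
    · simp
    · congr 1; ring
  rw [hrhs] at hthree
  refine le_trans ?_ hthree
  -- at `θ` the integrand is nonnegative
  have hFθ : F θ = ((∑ i ∈ s, h i ^ (1 - u) * ∫ x in E i, ‖v.1 x‖ : ℝ) : ℂ) := by
    simp only [hF, Complex.ofReal_sum]
    refine Finset.sum_congr rfl fun i hi => ?_
    rw [BanachCouple.toAmbientL_apply, hfv, hl i hi, Complex.ofReal_mul]
    simp only [hwv]
    rw [integral_complex_ofReal]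
    congr 1
    simp only [ha]
    rw [Real.rpow_def_of_pos (hh i), hu]
    push_cast
    congr 2
    ring
  rw [hFθ, Complex.norm_real]
  refine le_trans ?_ (Real.le_norm_self _)
  rw [hA, Finset.mul_sum]
  refine Finset.sum_le_sum fun i hi => ?_
  have hint : IntegrableOn (fun x => ‖v.1 x‖) (E i) := by
    obtain ⟨n, hn⟩ := hb i hi
    exact ((L1loc.integrableOn v n).mono_set hn).norm
  have h1 : c * h i ^ u * volume.real (E i) ≤ ∫ x in E i, ‖v.1 x‖ :=
    setIntegral_ge_of_const_le_real (hE i hi) (hfin i hi) (hv i hi) hint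
  calc c * (h i * volume.real (E i)) = h i ^ (1 - u) * (c * h i ^ u * volume.real (E i)) := by
        have : h i ^ (1 - u) * h i ^ u = h i := by rw [← Real.rpow_add (hh i)]; simp
        linear_combination (-(c * volume.real (E i))) * this
    _ ≤ _ := mul_le_mul_of_nonneg_left h1 (Real.rpow_nonneg (hh i).le _)

end

theorem subset_closedBall_of_floor_norm {E : Type*} [NormedAddCommGroup E] (m : ℕ) :
    {x : E | ⌊‖x‖⌋₊ = m} ⊆ Metric.closedBall 0 ((m + 1 : ℕ) : ℝ) := by
  rintro x rfl
  rw [mem_closedBall_zero_iff]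
  push_cast
  exact (Nat.lt_floor_add_one _).le

section

variable {d : ℕ} {p₀ p₁ pθ : ℝ≥0∞} [Fact (1 ≤ p₀)] [Fact (1 ≤ p₁)] {θ : ℝ}

/-- The case `p_θ = ∞`: the three lines estimate for a single set on which `|v|` exceeds the norm
of `f` shows that this set is null. -/
theorem eLpNorm_top_le_fnorm (h01 : θ ∈ Ioo (0 : ℝ) 1)
    (hθ : 0 = (1 - θ) * (p₀⁻¹).toReal + θ * (p₁⁻¹).toReal)
    (f : (lpCouple d p₀ p₁).SpaceGeneratingFunction) {v : L1loc d}
    (hfv : (lpCouple d p₀ p₁).toAmbient (f.toFun θ) = v) :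
    eLpNorm v.1 ∞ volume ≤ ENNReal.ofReal f.fnorm := by
  have hvm : Measurable fun x => ‖v.1 x‖ := (AEEqFun.stronglyMeasurable v.1).measurable.norm
  rw [eLpNorm_exponent_top]
  refine eLpNormEssSup_le_of_ae_enorm_bound ?_
  have key : ∀ k m : ℕ,
      volume ({x | f.fnorm + 1 / (k + 1) < ‖v.1 x‖} ∩ {x | ⌊‖x‖⌋₊ = m}) = 0 := by
    intro k m
    set E : Set (EuclideanSpace ℝ (Fin d)) :=
      {x | f.fnorm + 1 / (k + 1) < ‖v.1 x‖} ∩ {x | ⌊‖x‖⌋₊ = m} with hE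
    have hEm : MeasurableSet E := (measurableSet_lt measurable_const hvm).inter
      ((Nat.measurable_floor.comp measurable_norm) (measurableSet_singleton m))
    have hEb : E ⊆ Metric.closedBall 0 ((m + 1 : ℕ) : ℝ) :=
      inter_subset_right.trans (subset_closedBall_of_floor_norm m)
    have := mul_sum_le_fnorm_mul_rpow h01 f (Finset.univ : Finset Unit) (E := fun _ => E)
      (fun _ _ => hEm) (fun _ _ => ⟨m + 1, hEb⟩) (by simp)
      (h := fun _ => 1) (fun _ => one_pos) (u := 0) (c := f.fnorm + 1 / (k + 1)) hfv hθ
      (fun _ _ x hx => by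
        rw [Real.rpow_zero, mul_one]
        exact le_of_lt hx.1)
    simp only [Finset.univ_unique, Finset.sum_singleton, one_mul, sub_zero, Real.rpow_one,
      add_mul] at this
    have hk : (0 : ℝ) < 1 / (k + 1) := Nat.one_div_pos_of_nat
    have h0 : volume.real E = 0 := by
      have h1 : 0 ≤ volume.real E := measureReal_nonneg
      nlinarith
    exact (measureReal_eq_zero_iff
      ((measure_mono hEb).trans_lt measure_closedBall_lt_top).ne).1 h0
  have hall : ∀ᵐ x ∂(volume : Measure (EuclideanSpace ℝ (Fin d))), ∀ k m : ℕ,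
      x ∉ {x | f.fnorm + 1 / (k + 1) < ‖v.1 x‖} ∩ {x | ⌊‖x‖⌋₊ = m} := by
    rw [ae_all_iff]; intro k
    rw [ae_all_iff]; intro m
    exact measure_eq_zero_iff_ae_notMem.1 (key k m)
  filter_upwards [hall] with x hx
  rw [← ofReal_norm]
  refine ENNReal.ofReal_le_ofReal (le_of_forall_pos_le_add fun ε hε => ?_)
  obtain ⟨k, hk⟩ := exists_nat_one_div_lt hε
  have : ¬ f.fnorm + 1 / (k + 1) < ‖v.1 x‖ := fun h => hx k _ ⟨h, rfl⟩
  linarith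

/-- The case `p_θ < ∞`: the three lines estimate for the level sets
`{exp (k δ) ≤ |v| < exp ((k + 1) δ)}`, cut into bounded pieces, computes `∫ |v| ^ p_θ` up to the
factor `exp (δ p_θ)`. -/
theorem lintegral_rpow_le_fnorm (h01 : θ ∈ Ioo (0 : ℝ) 1) {q : ℝ} (hq : 0 < q)
    (hθ : q⁻¹ = (1 - θ) * (p₀⁻¹).toReal + θ * (p₁⁻¹).toReal)
    (f : (lpCouple d p₀ p₁).SpaceGeneratingFunction) {v : L1loc d}
    (hfv : (lpCouple d p₀ p₁).toAmbient (f.toFun θ) = v) {δ : ℝ} (hδ : 0 < δ) :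
    ∫⁻ x, ‖v.1 x‖ₑ ^ q ≤ ENNReal.ofReal (Real.exp (δ * q) * f.fnorm ^ q) := by
  have hvm : Measurable fun x => ‖v.1 x‖ := (AEEqFun.stronglyMeasurable v.1).measurable.norm
  set E : ℤ × ℕ → Set (EuclideanSpace ℝ (Fin d)) := fun i =>
    {x | ‖v.1 x‖ ≠ 0} ∩ {x | ⌊Real.log ‖v.1 x‖ / δ⌋ = i.1} ∩ {x | ⌊‖x‖⌋₊ = i.2} with hE
  have hEm : ∀ i, MeasurableSet (E i) := fun i =>
    (((hvm (measurableSet_singleton 0)).compl.inter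
      ((Int.measurable_floor.comp ((Real.measurable_log.comp hvm).div_const δ))
        (measurableSet_singleton i.1)))).inter
      ((Nat.measurable_floor.comp measurable_norm) (measurableSet_singleton i.2))
  have hEb : ∀ i, E i ⊆ Metric.closedBall 0 ((i.2 + 1 : ℕ) : ℝ) := fun i =>
    inter_subset_right.trans (subset_closedBall_of_floor_norm i.2)
  have hfin : ∀ i, volume (E i) ≠ ∞ := fun i =>
    ((measure_mono (hEb i)).trans_lt measure_closedBall_lt_top).ne
  have hEd : Pairwise (Function.onFun Disjoint E) := by
    intro i j hij
    refine Set.disjoint_left.2 fun x hx hy => hij ?_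
    exact Prod.ext (hx.1.2.symm.trans hy.1.2) (hx.2.symm.trans hy.2)
  have hElow : ∀ i, ∀ x ∈ E i, Real.exp (i.1 * δ) ≤ ‖v.1 x‖ := by
    rintro i x ⟨⟨hx0, hx1⟩, -⟩
    have hpos : 0 < ‖v.1 x‖ := lt_of_le_of_ne (norm_nonneg _) (Ne.symm hx0)
    rw [← Real.le_log_iff_exp_le hpos, ← le_div_iff₀ hδ, ← hx1]
    exact Int.floor_le _
  have hEup : ∀ i, ∀ x ∈ E i, ‖v.1 x‖ ≤ Real.exp ((i.1 + 1) * δ) := by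
    rintro i x ⟨⟨hx0, hx1⟩, -⟩
    have hpos : 0 < ‖v.1 x‖ := lt_of_le_of_ne (norm_nonneg _) (Ne.symm hx0)
    rw [← Real.log_le_iff_le_exp hpos, ← div_le_iff₀ hδ, ← hx1]
    exact (Int.lt_floor_add_one _).le
  -- the three lines estimate for finitely many pieces
  have hfinite : ∀ s : Finset (ℤ × ℕ),
      ∑ i ∈ s, Real.exp (i.1 * δ * q) * volume.real (E i) ≤ f.fnorm ^ q := by
    intro s
    have h1 := mul_sum_le_fnorm_mul_rpow h01 f s (fun i _ => hEm i) (fun i _ => ⟨_, hEb i⟩)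
      (hEd.set_pairwise _) (h := fun i => Real.exp (i.1 * δ * q)) (fun i => Real.exp_pos _)
      (u := q⁻¹) (c := 1) hfv hθ (fun i _ x hx => by
        rw [one_mul, ← Real.exp_mul, mul_assoc, mul_inv_cancel₀ hq.ne', mul_one]
        exact hElow i x hx)
    rw [one_mul] at h1
    set A := ∑ i ∈ s, Real.exp (i.1 * δ * q) * volume.real (E i) with hA
    have hA0 : 0 ≤ A := Finset.sum_nonneg fun i _ => by positivity
    rcases hA0.eq_or_lt with h0 | hApos
    · rw [← h0]; exact Real.rpow_nonneg f.fnorm_nonneg _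
    have h2 : A ^ q⁻¹ ≤ f.fnorm := by
      have h3 : A = A ^ q⁻¹ * A ^ (1 - q⁻¹) := by rw [← Real.rpow_add hApos]; simp
      rw [h3] at h1
      have h4 : (A ^ q⁻¹ * A ^ (1 - q⁻¹)) ^ (1 - q⁻¹) = A ^ (1 - q⁻¹) := by rw [← h3]
      rw [h4] at h1
      exact le_of_mul_le_mul_right h1 (Real.rpow_pos_of_pos hApos _)
    calc A = (A ^ q⁻¹) ^ q := by rw [← Real.rpow_mul hA0, inv_mul_cancel₀ hq.ne', Real.rpow_one]
      _ ≤ _ := Real.rpow_le_rpow (Real.rpow_nonneg hA0 _) h2 hq.le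
  have hcover : ∫⁻ x, ‖v.1 x‖ₑ ^ q = ∑' i, ∫⁻ x in E i, ‖v.1 x‖ₑ ^ q := by
    rw [← lintegral_iUnion hEm hEd, ← lintegral_indicator (MeasurableSet.iUnion hEm)]
    refine lintegral_congr fun x => ?_
    by_cases hx : ‖v.1 x‖ = 0
    · have h0 : ‖v.1 x‖ₑ ^ q = 0 := by
        rw [← ofReal_norm, hx, ENNReal.ofReal_zero, ENNReal.zero_rpow_of_pos hq]
      by_cases hm : x ∈ ⋃ i, E i
      · rw [Set.indicator_of_mem hm]
      · rw [Set.indicator_of_notMem hm, h0]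
    · have hmem : x ∈ ⋃ i, E i :=
        mem_iUnion.2 ⟨(⌊Real.log ‖v.1 x‖ / δ⌋, ⌊‖x‖⌋₊), ⟨hx, rfl⟩, rfl⟩
      rw [Set.indicator_of_mem hmem]
  rw [hcover, ENNReal.tsum_eq_iSup_sum]
  refine iSup_le fun s => ?_
  calc ∑ i ∈ s, ∫⁻ x in E i, ‖v.1 x‖ₑ ^ q
      ≤ ∑ i ∈ s, ENNReal.ofReal (Real.exp (δ * q) *
          (Real.exp (i.1 * δ * q) * volume.real (E i))) := by
        refine Finset.sum_le_sum fun i _ => ?_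
        have : ∀ x ∈ E i, ‖v.1 x‖ₑ ^ q ≤ ENNReal.ofReal (Real.exp ((i.1 + 1) * δ * q)) := by
          intro x hx
          rw [← ofReal_norm, ENNReal.ofReal_rpow_of_nonneg (norm_nonneg _) hq.le, Real.exp_mul]
          exact ENNReal.ofReal_le_ofReal
            (Real.rpow_le_rpow (norm_nonneg _) (hEup i x hx) hq.le)
        refine (setLIntegral_mono' (hEm i) this).trans_eq ?_
        rw [setLIntegral_const, ← mul_assoc, ← Real.exp_add,
          ENNReal.ofReal_mul (Real.exp_pos _).le, ofReal_measureReal (hfin i)]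
        congr 3
        ring
    _ = ENNReal.ofReal (Real.exp (δ * q) *
          ∑ i ∈ s, Real.exp (i.1 * δ * q) * volume.real (E i)) := by
        rw [Finset.mul_sum, ENNReal.ofReal_sum_of_nonneg fun i _ => by positivity]
    _ ≤ _ := ENNReal.ofReal_le_ofReal
        (mul_le_mul_of_nonneg_left (hfinite s) (Real.exp_pos _).le)

/-- The norm of `L^{p_θ}` is at most that of the interpolation space. For `p_θ < ∞` the mesh `δ` of
the level sets tends to zero. -/
theorem eLpNorm_le_fnorm (h01 : θ ∈ Ioo (0 : ℝ) 1) (hp : 1 ≤ pθ)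
    (hθ : (pθ⁻¹).toReal = (1 - θ) * (p₀⁻¹).toReal + θ * (p₁⁻¹).toReal)
    (f : (lpCouple d p₀ p₁).SpaceGeneratingFunction) {v : L1loc d}
    (hfv : (lpCouple d p₀ p₁).toAmbient (f.toFun θ) = v) :
    eLpNorm v.1 pθ volume ≤ ENNReal.ofReal f.fnorm := by
  rcases eq_or_ne pθ ∞ with rfl | hpt
  · exact eLpNorm_top_le_fnorm h01 (by simpa using hθ) f hfv
  have hq : 0 < pθ.toReal := ENNReal.toReal_pos (zero_lt_one.trans_le hp).ne' hpt
  rw [ENNReal.toReal_inv] at hθ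
  have hlim : ∫⁻ x, ‖v.1 x‖ₑ ^ pθ.toReal ≤ ENNReal.ofReal (f.fnorm ^ pθ.toReal) := by
    have hc : Filter.Tendsto (fun δ : ℝ => ENNReal.ofReal (Real.exp (δ * pθ.toReal) *
        f.fnorm ^ pθ.toReal)) (𝓝[>] 0) (𝓝 (ENNReal.ofReal (f.fnorm ^ pθ.toReal))) := by
      have : Continuous fun δ : ℝ => ENNReal.ofReal (Real.exp (δ * pθ.toReal) *
        f.fnorm ^ pθ.toReal) := ENNReal.continuous_ofReal.comp (by fun_prop)
      simpa using (this.tendsto 0).mono_left nhdsWithin_le_nhds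
    exact ge_of_tendsto hc (eventually_mem_nhdsWithin.mono fun δ hδ =>
      lintegral_rpow_le_fnorm h01 hq hθ f hfv hδ)
  rw [eLpNorm_eq_lintegral_rpow_enorm_toReal (zero_lt_one.trans_le hp).ne' hpt, one_div,
    ENNReal.rpow_inv_le_iff hq, ENNReal.ofReal_rpow_of_nonneg f.fnorm_nonneg hq.le]
  exact hlim

/-- Every `v ∈ L^{p_θ}` is generated by functions whose norms exceed `‖v‖` arbitrarily little. -/
theorem exists_spaceGeneratingFunction [Fact (1 ≤ pθ)] (h01 : θ ∈ Ioo (0 : ℝ) 1)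
    (hθ : (pθ⁻¹).toReal = (1 - θ) * (p₀⁻¹).toReal + θ * (p₁⁻¹).toReal)
    (v : Lp ℂ pθ (volume : Measure (EuclideanSpace ℝ (Fin d)))) {ε : ℝ} (hε : 0 < ε) :
    ∃ F : (lpCouple d p₀ p₁).SpaceGeneratingFunction,
      (lpCouple d p₀ p₁).toAmbient (F.toFun θ) = lpInclusion d pθ v ∧
      F.fnorm ≤ Real.exp ε * (‖v‖ + 2 * ε) := by
  rcases eq_or_ne pθ ∞ with rfl | hpt
  · have hp : ∀ p : ℝ≥0∞, 1 ≤ p → (p⁻¹).toReal = 0 → p = ∞ := fun p hp h => by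
      rcases (ENNReal.toReal_eq_zero_iff _).1 h with h | h
      · exact ENNReal.inv_eq_zero.1 h
      · exact absurd (ENNReal.inv_eq_top.1 h) (zero_lt_one.trans_le hp).ne'
    have h0 : 0 ≤ (1 - θ) * (p₀⁻¹).toReal := mul_nonneg (by linarith [h01.2]) ENNReal.toReal_nonneg
    have h1 : 0 ≤ θ * (p₁⁻¹).toReal := mul_nonneg h01.1.le ENNReal.toReal_nonneg
    simp only [ENNReal.inv_top, ENNReal.toReal_zero] at hθ
    have e0 : (1 - θ) * (p₀⁻¹).toReal = 0 := by linarith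
    have e1 : θ * (p₁⁻¹).toReal = 0 := by linarith
    obtain rfl := hp p₀ Fact.out ((mul_eq_zero.1 e0).resolve_left (by linarith [h01.2]))
    obtain rfl := hp p₁ Fact.out ((mul_eq_zero.1 e1).resolve_left h01.1.ne')
    obtain ⟨F, hF, hFn⟩ := exists_spaceGeneratingFunction_top (θ := θ) v hε
    exact ⟨F, hF, hFn.trans (mul_le_mul_of_nonneg_left (by linarith) (Real.exp_pos _).le)⟩
  · exact exists_spaceGeneratingFunction_of_ne_top h01 hθ hpt v hε

end

theorem mainTheorem6 (d : ℕ) (p₀ p₁ : ℝ≥0∞) [Fact (1 ≤ p₀)] [Fact (1 ≤ p₁)]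
    (θ : ℝ) (hθ : θ ∈ Set.Ioo (0 : ℝ) 1) (pθ : ℝ≥0∞)
    (hpθ : pθ⁻¹ = ENNReal.ofReal (1 - θ) * p₀⁻¹ + ENNReal.ofReal θ * p₁⁻¹) :
    ((lpCouple d p₀ p₁).interpolationSpace θ).map (L1loc d).subtype =
        Lp.LpSubmodule ℂ ℂ pθ (volume : Measure (EuclideanSpace ℝ (Fin d))) ∧
      ∀ v ∈ (lpCouple d p₀ p₁).interpolationSpace θ,
        (lpCouple d p₀ p₁).interpolationNorm θ v =
          (eLpNorm (v : EuclideanSpace ℝ (Fin d) →ₘ[volume] ℂ) pθ volume).toReal := by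
  have hi₀ : p₀⁻¹ ≤ 1 := ENNReal.inv_le_one.2 Fact.out
  have hi₁ : p₁⁻¹ ≤ 1 := ENNReal.inv_le_one.2 Fact.out
  have hθ1 : 0 ≤ 1 - θ := by linarith [hθ.2]
  have hp : 1 ≤ pθ := by
    rw [← ENNReal.inv_le_one, hpθ]
    calc _ ≤ ENNReal.ofReal (1 - θ) * 1 + ENNReal.ofReal θ * 1 := by gcongr
      _ = 1 := by
        rw [mul_one, mul_one, ← ENNReal.ofReal_add hθ1 hθ.1.le]
        simp
  have : Fact (1 ≤ pθ) := ⟨hp⟩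
  have hu : (pθ⁻¹).toReal = (1 - θ) * (p₀⁻¹).toReal + θ * (p₁⁻¹).toReal := by
    have hf₀ : p₀⁻¹ ≠ ∞ := (hi₀.trans_lt ENNReal.one_lt_top).ne
    have hf₁ : p₁⁻¹ ≠ ∞ := (hi₁.trans_lt ENNReal.one_lt_top).ne
    rw [hpθ, ENNReal.toReal_add (ENNReal.mul_ne_top ENNReal.ofReal_ne_top hf₀)
      (ENNReal.mul_ne_top ENNReal.ofReal_ne_top hf₁), ENNReal.toReal_mul, ENNReal.toReal_mul,
      ENNReal.toReal_ofReal hθ1, ENNReal.toReal_ofReal hθ.1.le]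
  have hmem : ∀ v ∈ (lpCouple d p₀ p₁).interpolationSpace θ, v.1 ∈ Lp ℂ pθ volume := by
    rintro v ⟨f, hf⟩
    exact (eLpNorm_le_fnorm hθ hp hu f hf).trans_lt ENNReal.ofReal_lt_top
  refine ⟨le_antisymm ?_ fun g hg => ?_, fun v hv => le_antisymm ?_ ?_⟩
  · rintro _ ⟨v, hv, rfl⟩
    exact hmem v hv
  · obtain ⟨F, hF, -⟩ := exists_spaceGeneratingFunction (p₀ := p₀) (p₁ := p₁) hθ hu
      (⟨g, hg⟩ : Lp ℂ pθ volume) one_pos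
    exact ⟨lpInclusion d pθ ⟨g, hg⟩, ⟨F, hF⟩, rfl⟩
  · have hbound : ∀ ε : ℝ, 0 < ε → (lpCouple d p₀ p₁).interpolationNorm θ v ≤
        Real.exp ε * ((eLpNorm v.1 pθ volume).toReal + 2 * ε) := by
      intro ε hε
      obtain ⟨F, hF, hFn⟩ := exists_spaceGeneratingFunction (p₀ := p₀) (p₁ := p₁) hθ hu
        (⟨v.1, hmem v hv⟩ : Lp ℂ pθ volume) hε
      refine le_trans (csInf_le ⟨0, ?_⟩ ⟨F, hF, rfl⟩) hFn
      rintro _ ⟨f, -, rfl⟩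
      exact f.fnorm_nonneg
    have hc : Filter.Tendsto (fun ε : ℝ => Real.exp ε * ((eLpNorm v.1 pθ volume).toReal + 2 * ε))
        (𝓝[>] 0) (𝓝 (eLpNorm v.1 pθ volume).toReal) := by
      have : Continuous fun ε : ℝ => Real.exp ε * ((eLpNorm v.1 pθ volume).toReal + 2 * ε) := by
        fun_prop
      simpa using (this.tendsto 0).mono_left nhdsWithin_le_nhds
    exact ge_of_tendsto hc (eventually_mem_nhdsWithin.mono fun ε hε => hbound ε hε)
  · obtain ⟨f₀, hf₀⟩ := hv
    refine le_csInf ⟨_, f₀, hf₀, rfl⟩ ?_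
    rintro _ ⟨f, hf, rfl⟩
    exact ENNReal.toReal_le_of_le_ofReal f.fnorm_nonneg (eLpNorm_le_fnorm hθ hp hu f hf)
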